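/- Let $\mathbb F$ be an algebraically closed field of characteristic $0$, let $\mathcal S\subset\mathbb Z$ be finite, with a nonzero weight $w_i\in\mathbb F$ for each $i\in\mathcal S$, and suppose that the smallest element of $\mathcal S$ is $-m$ and the largest is $M$, with $m\ge 0$ and $M>0$. Let $S(x)=\sum_{i\in\mathcal S}w_ix^i$ and $K(x)=1-tS(x)$. Let $Q(x)\equiv Q(x;t)\in\mathbb F[x][[t]]$ be the generating function of walks on $\mathbb N$ that start at $0$ and take their steps in $\mathcal S$, where a walk of length $n$ ending at $i$ contributes $x^it^n$ times the product of the weights of its steps. Let $Q_i\in\mathbb F[[t]]$ be the coefficient of $x^i$ in $Q(x)$. (1) Let $L$ be an algebraic closure of $\mathbb F(x)$. Call two distinct nonzero elements $u,v$ of $L$ adjacent if $S(u)=S(v)$, and let the orbit of $x$ be its class for the reflexive transitive closure of this relation. The orbit of $x$ has cardinality $m+M$. For every $u$ in the orbit, the orbit equation $$K(x)Q(u)=1-t\sum_{k\in\mathcal S}w_ku^k\sum_{0\le i<-k}u^iQ_i$$ holds in $L[[t]]$. Call section-free equation any linear combination, with coefficients in $L$, of the orbit equations (seen as formal linear equations in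 the symbols $Q(u)$, for $u$ in the orbit, and the sections $Q_0,\dots,Q_{m-1}$) in which the coefficient of each section $Q_0,\dots,Q_{m-1}$ is zero. Then the vector space of section-free equations is the $L$-linear span of the equations $$K(x)\sum_{i=0}^m\frac{u_i^m}{\prod_{j\ne i}(u_i-u_j)}\,Q(u_i)=1,$$ where $u_0,\dots,u_m$ are any distinct elements of the orbit of $x$; moreover, each of these equations holds in $L[[t]]$. (2) Let $\bar x=1/x$. The equation $S(X)=S(x)$, solved for $X\neq 0$, has exactly $m+M$ distinct roots in the field of Puiseux series in $\bar x$ with coefficients in $\mathbb F$. Exactly $m$ of these roots, denoted $x_1,\dots,x_m$, contain no positive power of $x$, and these have no constant term either. Moreover $$Q(x)=[x^{\ge}]\,\frac{\prod_{j=1}^m(1-\bar x x_j)}{K(x)},$$ where the fraction is expanded first in $t$, then in $\bar x$ (that is, as a power series in $t$ whose coefficients are Puiseux series in $\bar x$), and $[x^\ge]$ keeps, in the coefficient of each power of $t$, the terms with a non-negative power of $x$. (3) If $M=1$, the fraction in (2) is rational, equal to $\dfrac{S'(x)}{w_1K(x)}$, and $$Q(x)=[x^{\ge}]\,\frac{S'(x)}{w_1K(x)}.$$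 -/

import Mathlib

noncomputable section

namespace WeightedWalk

/-- A weighted one-dimensional model over `F`: a finite set of integer steps, each of them
carrying a nonzero weight (the values of `weight` outside `steps` are never used). -/
structure Model (F : Type*) [Field F] where
  steps : Finset ℤ
  weight : ℤ → F
  weight_ne_zero : ∀ s ∈ steps, weight s ≠ 0

/-! ### Walks confined to `ℕ` and their generating function -/

section Walks

variable {F : Type*} [Field F] (W : Model F)

/-- The walks of length `n` with steps in the step set that start from `0` and stay in `ℕ`,
as sequences of steps. -/
def Model.walks (n : ℕ) : Finset (Fin n → ℤ) :=
  (Fintype.piFinset fun _ : Fin n => W.steps).filter fun s =>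
    ∀ j : Fin n, 0 ≤ ∑ i ∈ Finset.Iic j, s i

/-- The weight of a walk: the product of the weights of its steps. -/
def Model.walkWeight {n : ℕ} (s : Fin n → ℤ) : F := ∏ i, W.weight (s i)

/-- `Q(u; t)`: the generating function `∑ weight · u ^ (endpoint) · t ^ (length)` of the walks,
with its first variable evaluated at `u`; it is a power series in `t`. -/
def Model.Q {A : Type*} [Field A] [Algebra F A] (u : A) : PowerSeries A :=
  PowerSeries.mk fun n =>
    ∑ s ∈ W.walks n, algebraMap F A (W.walkWeight s) * u ^ (∑ i, s i)

/-- The section `Q_k`: the generating function in `t` of the walks that end at abscissa `k`,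
with coefficients taken in the extension `A` of `F`. -/
def Model.sectionGF (A : Type*) [Field A] [Algebra F A] (k : ℕ) : PowerSeries A :=
  PowerSeries.mk fun n =>
    ∑ s ∈ W.walks n with ∑ i, s i = (k : ℤ), algebraMap F A (W.walkWeight s)

/-- The step polynomial `S(u) = ∑ wᵢ uⁱ`. -/
def Model.S {A : Type*} [Field A] [Algebra F A] (u : A) : A :=
  ∑ i ∈ W.steps, algebraMap F A (W.weight i) * u ^ i

/-- The derivative `S'(u) = ∑ i wᵢ uⁱ⁻¹` of the step polynomial. -/
def Model.S' {A : Type*} [Field A] [Algebra F A] (u : A) : A :=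
  ∑ i ∈ W.steps, (i : A) * algebraMap F A (W.weight i) * u ^ (i - 1)

/-- The kernel `K(u) = 1 - t S(u)`. -/
def Model.K {A : Type*} [Field A] [Algebra F A] (u : A) : PowerSeries A :=
  1 - PowerSeries.X * PowerSeries.C (W.S u)

end Walks

/-! ### The orbit -/

section Orbit

variable {F : Type*} [Field F] (W : Model F) {A : Type*} [Field A] [Algebra F A]

/-- Adjacency, in dimension one, of two nonzero elements. -/
def Model.Adjacent (u v : A) : Prop := u ≠ 0 ∧ v ≠ 0 ∧ u ≠ v ∧ W.S u = W.S v

/-- The orbit of `u`: its class for the reflexive transitive closure of the (symmetric)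
adjacency relation. -/
def Model.orbit (u : A) : Set A := {v | Relation.ReflTransGen W.Adjacent u v}

end Orbit

/-! ### Section-free equations -/

section SectionFree

variable {F : Type*} [Field F] (W : Model F) {A : Type*} [Field A] [Algebra F A]

/-- A formal linear equation, with coefficients in `A⟦t⟧`, between symbols `Q(u)` for `u : A`
and symbols for the sections `Q_0, …, Q_{m-1}`. The triple `(a, b, c)` stands for
`∑ a(u) Q(u) = ∑ b(i) Q_i + c`. -/
abbrev Equation (A : Type*) [Field A] (m : ℕ) : Type _ :=
  (A →₀ PowerSeries A) × (Fin m → PowerSeries A) × PowerSeries A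

/-- The equation becomes true when the symbols `Q(u)` and `Q_i` are replaced by the
corresponding generating functions. -/
def Model.Holds {m : ℕ} (e : Equation A m) : Prop :=
  (e.1.sum fun u a => a * W.Q u) = ∑ i, e.2.1 i * W.sectionGF A i + e.2.2

/-- The orbit equation associated with an element `u` of the orbit of `x`:
`K(x) Q(u) = 1 - t ∑_{k ∈ steps} w_k u^k ∑_{0 ≤ i < -k} u^i Q_i`. -/
def Model.orbitEquation (m : ℕ) (x u : A) : Equation A m :=
  (Finsupp.single u (W.K x),
    fun i => -(PowerSeries.X * PowerSeries.C
      (∑ k ∈ W.steps with ((i : ℕ) : ℤ) < -k,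
        algebraMap F A (W.weight k) * u ^ k * u ^ (i : ℕ))),
    1)

/-- The section-free equations: the linear combinations, with coefficients in `A`, of the orbit
equations in which no section occurs. -/
def Model.sectionFree (m : ℕ) (x : A) : Submodule A (Equation A m) :=
  Submodule.span A {e | ∃ u ∈ W.orbit x, e = W.orbitEquation m x u} ⊓
    LinearMap.ker (LinearMap.fst A (Fin m → PowerSeries A) (PowerSeries A) ∘ₗ
      LinearMap.snd A (A →₀ PowerSeries A) ((Fin m → PowerSeries A) × PowerSeries A))

/-- The coefficient `u_i ^ m / ∏_{j ≠ i} (u_i - u_j)`. -/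
def lagrangeCoeff {m : ℕ} (u : Fin (m + 1) → A) (i : Fin (m + 1)) : A :=
  u i ^ m / ∏ j ∈ Finset.univ.erase i, (u i - u j)

/-- The equation `∑_i K(x) · u_i ^ m / ∏_{j ≠ i} (u_i - u_j) · Q(u_i) = 1`. -/
def Model.lagrangeEquation {m : ℕ} (x : A) (u : Fin (m + 1) → A) : Equation A m :=
  (∑ i, Finsupp.single (u i) (W.K x * PowerSeries.C (lagrangeCoeff u i)), 0, 1)

end SectionFree

/-! ### Puiseux series in `x̄ = 1/x` -/

section Puiseux

variable (F : Type*) [Field F]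

/-- `f` has exponents in `(1/n) ℤ` iff it is a Laurent series in the `n`-th root of the
variable. -/
theorem exists_embDomain {n : ℕ} (hn : 0 < n) (f : HahnSeries ℚ F)
    (hf : ∀ q ∈ f.support, ∃ k : ℤ, q = k / n) :
    ∃ (φ : HahnSeries ℤ F →+* HahnSeries ℚ F) (g : HahnSeries ℤ F), φ g = f ∧
      ∀ h, ∀ q ∈ (φ h).support, ∃ k : ℤ, q = k / n := by
  have hn' : (0 : ℚ) < n := by exact_mod_cast hn
  let ι : ℤ →+ ℚ :=
    { toFun := fun k => (k : ℚ) / n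
      map_zero' := by simp
      map_add' := fun a b => by push_cast; ring }
  have hle : ∀ a b : ℤ, ι a ≤ ι b ↔ a ≤ b := fun a b => by
    change (a : ℚ) / n ≤ (b : ℚ) / n ↔ a ≤ b
    rw [div_le_div_iff_of_pos_right hn']
    exact_mod_cast Iff.rfl
  have hinj : Function.Injective ι := fun a b h =>
    le_antisymm ((hle a b).1 h.le) ((hle b a).1 h.ge)
  have key : ∀ h : HahnSeries ℤ F, ∀ q ∈ (HahnSeries.embDomainRingHom ι hinj hle h).support,
      ∃ k : ℤ, q = k / n := by
    intro h q hq
    obtain ⟨k, -, hk⟩ := HahnSeries.support_embDomain_subset hq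
    exact ⟨k, hk.symm⟩
  refine ⟨HahnSeries.embDomainRingHom ι hinj hle,
    ⟨fun k => f.coeff (ι k), ?_⟩, ?_, key⟩
  · rw [Set.isPWO_iff_isWF]
    have hwf : f.support.IsWF := f.isWF_support
    rw [Set.isWF_iff_no_descending_seq] at hwf ⊢
    intro s hs hmem
    refine hwf (fun i => ι (s i)) (fun a b hab => ?_) (fun i => hmem i)
    exact lt_of_le_of_ne ((hle _ _).2 (hs hab).le) (fun h => (hs hab).ne (hinj h))
  · ext q
    by_cases hq : ∃ k : ℤ, q = k / n
    · obtain ⟨k, rfl⟩ := hq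
      exact HahnSeries.embDomain_coeff (f := ⟨⟨ι, hinj⟩, hle _ _⟩)
    · have h1 : f.coeff q = 0 := by
        by_contra h
        exact hq (hf q h)
      rw [h1]
      by_contra h
      exact hq (key _ q h)

/-- The field of Puiseux series with coefficients in `F`: the Hahn series with rational exponents
all of whose exponents are multiples of `1/n` for some positive integer `n` (well-ordered
support then bounds the exponents from below). The variable is called `x̄`: the coefficient with
index `q` is the coefficient of `x̄ ^ q`. -/
def Puiseux : Subfield (HahnSeries ℚ F) where
  carrier := {f | ∃ n : ℕ, 0 < n ∧ ∀ q ∈ f.support, ∃ k : ℤ, q = k / n}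
  mul_mem' := by
    rintro f g ⟨n, hn, hf⟩ ⟨p, hp, hg⟩
    refine ⟨n * p, Nat.mul_pos hn hp, fun q hq => ?_⟩
    obtain ⟨a, ha, b, hb, rfl⟩ := HahnSeries.support_mul_subset hq
    obtain ⟨k, rfl⟩ := hf a ha
    obtain ⟨l, rfl⟩ := hg b hb
    have : (n : ℚ) ≠ 0 := by positivity
    have : (p : ℚ) ≠ 0 := by positivity
    refine ⟨k * p + l * n, ?_⟩
    push_cast
    field_simp
  add_mem' := by
    rintro f g ⟨n, hn, hf⟩ ⟨p, hp, hg⟩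
    refine ⟨n * p, Nat.mul_pos hn hp, fun q hq => ?_⟩
    have : (n : ℚ) ≠ 0 := by positivity
    have : (p : ℚ) ≠ 0 := by positivity
    rcases HahnSeries.support_add_subset f g hq with h | h
    · obtain ⟨k, rfl⟩ := hf q h
      exact ⟨k * p, by push_cast; field_simp⟩
    · obtain ⟨k, rfl⟩ := hg q h
      exact ⟨k * n, by push_cast; field_simp⟩
  zero_mem' := ⟨1, one_pos, fun q hq => absurd hq (by simp)⟩
  one_mem' := ⟨1, one_pos, fun q hq => ⟨0, by
    simpa using HahnSeries.support_single_subset (a := (0 : ℚ)) (r := (1 : F)) hq⟩⟩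
  neg_mem' := by
    rintro f ⟨n, hn, hf⟩
    exact ⟨n, hn, fun q hq => hf q (by simpa using hq)⟩
  inv_mem' := by
    rintro f ⟨n, hn, hf⟩
    obtain ⟨φ, g, rfl, hφ⟩ := exists_embDomain F hn f hf
    exact ⟨n, hn, by rw [← map_inv₀]; exact hφ _⟩

/-- Elements of `F` are seen as constant Puiseux series. -/
instance : Algebra F (Puiseux F) :=
  RingHom.toAlgebra ((HahnSeries.C : F →+* HahnSeries ℚ F).codRestrict (Puiseux F) fun r =>
    ⟨1, one_pos, fun q hq => ⟨0, by
      simpa using HahnSeries.support_single_subset (a := (0 : ℚ)) (r := r) hq⟩⟩)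

/-- The Puiseux series `x̄`. -/
def xbar : Puiseux F :=
  ⟨HahnSeries.single 1 1, 1, one_pos, fun q hq =>
    ⟨1, by simpa using HahnSeries.support_single_subset hq⟩⟩

variable {F}

/-- The coefficient of `x ^ q`, that is, of `x̄ ^ (-q)`. -/
def xCoeff (q : ℚ) (f : Puiseux F) : F := (f : HahnSeries ℚ F).coeff (-q)

/-- The part of a Puiseux series in `x̄` formed of the terms with a non-negative power of `x`. -/
def nonnegPart (f : Puiseux F) : Puiseux F :=
  ⟨⟨fun q => if q ≤ 0 then (f : HahnSeries ℚ F).coeff q else 0,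
    (f : HahnSeries ℚ F).isPWO_support'.mono fun q hq => by
      by_contra h
      exact hq (by simp [Function.notMem_support.1 h])⟩,
    by
      obtain ⟨n, hn, hf⟩ := f.2
      refine ⟨n, hn, fun q hq => hf q fun h => hq ?_⟩
      simp [h]⟩

/-- `[x^≥] f`, for a power series in `t` whose coefficients are Puiseux series in `x̄`: the
non-negative part in `x` is taken coefficient by coefficient. -/
def nonnegPartSeries (f : PowerSeries (Puiseux F)) : PowerSeries (Puiseux F) :=
  PowerSeries.mk fun n => nonnegPart (PowerSeries.coeff n f)

end Puiseux

/-! ### The roots of `S(X) = S(x)` -/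

section Roots

variable {F : Type*} [Field F] (W : Model F)

/-- The roots `X` of `S(X) = S(x)` in the field of Puiseux series in `x̄`, where `x = 1 / x̄`. -/
def Model.roots : Set (Puiseux F) := {X | X ≠ 0 ∧ W.S X = W.S (xbar F)⁻¹}

/-- The roots that contain no positive power of `x`. -/
def Model.smallRoots : Set (Puiseux F) :=
  {X | X ∈ W.roots ∧ ∀ q : ℚ, 0 < q → xCoeff q X = 0}

end Roots

end WeightedWalk

end

/-! Removing the last step of a walk gives, for every nonzero `u`, a linear equation for `Q(u)` in
which `K(u)` involves `u` only through `S(u)`. The factor `K(x)` is therefore common to the whole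
orbit, which is the level set `S(u) = S(x)`. That set is the zero set of `X ^ m * (S(X) - S(x))`, of
degree `m + M` (`kernelPoly`). Since `S(x)` is not in `F`, `0` is not a root. A double root would
annihilate `S'`, hence be algebraic over `F`, hence lie in `F`, and `S(x)` with it.

Section-free equations: the coefficient of `Q_i` at `u` combines `u ^ (-1), …, u ^ (i - m)`, with
`w_{-m} ≠ 0` in front of `u ^ (i - m)`. By triangularity, a combination with coefficients `a(u)` is
section-free iff the sums of `a(u) u ^ (-j)` vanish for `1 ≤ j ≤ m`, that is, iff the weights `a(u)
u ^ (-m)` kill all polynomials of degree less than `m`. Such functionals are spanned by divided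
differences of order `m` (`mem_span_dividedDifference`), which are the Lagrange equations.

Puiseux roots: Hensel's lemma gives `M` roots of leading order `x` and `m` roots of leading order
`x̄ ^ (M/m)`; the degree bound shows that there are no others.

Extraction: with `D = ∏ (X - x_j)`, on the orbit `u ^ m [t ^ n] Q(u) = S(x) ^ n D(u) + B(u)` with
`deg B < m`. At the `x_j` the term in `D` vanishes, so `B` is the remainder modulo `D` of a
polynomial over `F`, and its coefficients contain no positive power of `x`. Hence `x̄ ^ m B(x)` has
only negative powers of `x`, and `[x^≥]` removes it. For `M = 1`, the orbit is `x, x_1, …, x_m`, and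
differentiating the factored kernel polynomial at `x` turns the product into `S'(x) / w_1`. -/

noncomputable section

namespace WeightedWalk

/-! ### Walks and the functional equation. -/

section Walks

variable {F : Type*} [Field F] (W : Model F)

theorem Model.mem_walks {n : ℕ} {s : Fin n → ℤ} :
    s ∈ W.walks n ↔ (∀ i, s i ∈ W.steps) ∧ ∀ j : Fin n, 0 ≤ ∑ i ∈ Finset.Iic j, s i := by
  simp [Model.walks]

theorem Model.sum_nonneg_of_mem_walks {n : ℕ} {s : Fin n → ℤ} (hs : s ∈ W.walks n) :
    0 ≤ ∑ i, s i := by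
  cases n with
  | zero => simp
  | succ n =>
    have h := (W.mem_walks.1 hs).2 (Fin.last n)
    have : Finset.Iic (Fin.last n) = Finset.univ := by
      ext i; simp [Fin.le_last]
    rwa [this] at h

theorem sum_Iic_snoc_castSucc {n : ℕ} (s : Fin n → ℤ) (k : ℤ) (j : Fin n) :
    ∑ i ∈ Finset.Iic j.castSucc, (Fin.snoc s k : Fin (n + 1) → ℤ) i = ∑ i ∈ Finset.Iic j, s i := by
  have h1 : ∀ {p : ℕ} (j : Fin p) (f : Fin p → ℤ),
      ∑ i ∈ Finset.Iic j, f i = ∑ i, if i ≤ j then f i else 0 := by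
    intro p j f
    rw [← Finset.sum_filter]
    congr 1
    ext i; simp
  rw [h1, h1, Fin.sum_univ_castSucc]
  simp

theorem Model.snoc_mem_walks {n : ℕ} {s : Fin n → ℤ} {k : ℤ} :
    (Fin.snoc s k : Fin (n + 1) → ℤ) ∈ W.walks (n + 1) ↔
      s ∈ W.walks n ∧ k ∈ W.steps ∧ 0 ≤ ∑ i, s i + k := by
  have hlast : Finset.Iic (Fin.last n) = Finset.univ := by
    ext i; simp [Fin.le_last]
  simp only [W.mem_walks, Fin.forall_fin_succ', Fin.snoc_castSucc, Fin.snoc_last,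
    sum_Iic_snoc_castSucc, hlast, Fin.sum_univ_castSucc]
  tauto

/-- A nonempty walk is a walk followed by a step that does not leave `ℕ`. -/
theorem Model.sum_walks_succ {A : Type*} [AddCommMonoid A] (n : ℕ) (f : (Fin (n + 1) → ℤ) → A) :
    ∑ s ∈ W.walks (n + 1), f s =
      ∑ s ∈ W.walks n, ∑ k ∈ W.steps with 0 ≤ ∑ i, s i + k, f (Fin.snoc s k) := by
  rw [Finset.sum_sigma']
  refine Finset.sum_bij' (fun s _ => ⟨Fin.init s, s (Fin.last n)⟩) (fun p _ => Fin.snoc p.1 p.2)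
    ?_ ?_ ?_ ?_ ?_
  · intro s hs
    rw [← Fin.snoc_init_self s, W.snoc_mem_walks] at hs
    simpa using hs
  · rintro ⟨s, k⟩ hp
    rw [W.snoc_mem_walks]
    simpa using hp
  · intro s _
    simp
  · rintro ⟨s, k⟩ _
    simp
  · intro s _
    simp

theorem Model.walkWeight_snoc {n : ℕ} (s : Fin n → ℤ) (k : ℤ) :
    W.walkWeight (Fin.snoc s k : Fin (n + 1) → ℤ) = W.walkWeight s * W.weight k := by
  simp [Model.walkWeight, Fin.prod_univ_castSucc]

variable {A : Type*} [Field A] [Algebra F A]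

theorem Model.coeff_zero_Q (u : A) : PowerSeries.coeff 0 (W.Q u) = 1 := by
  have : W.walks 0 = Finset.univ :=
    Finset.eq_univ_iff_forall.2 fun s => by simp [W.mem_walks]
  simp [Model.Q, this, Model.walkWeight]

/-- The coefficient of the section `Q_i` in the orbit equation of `u`, up to a factor `-t`. -/
def Model.sectionCoeff (u : A) (i : ℕ) : A :=
  ∑ k ∈ W.steps with (i : ℤ) < -k, algebraMap F A (W.weight k) * u ^ k * u ^ i

variable {W} in
-- Appending an arbitrary step multiplies by `S(u)`; the steps that leave `ℕ` are then subtracted,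
-- sorted by the endpoint `i` they start from. No step goes below `-m`, so only endpoints `i < m`
-- contribute.
theorem Model.coeff_succ_Q {m : ℕ} (hm : ∀ k ∈ W.steps, -(m : ℤ) ≤ k) {u : A} (hu : u ≠ 0)
    (n : ℕ) :
    PowerSeries.coeff (n + 1) (W.Q u) = W.S u * PowerSeries.coeff n (W.Q u) -
      ∑ i : Fin m, W.sectionCoeff u i * PowerSeries.coeff n (W.sectionGF A i) := by
  simp only [Model.Q, Model.sectionGF, PowerSeries.coeff_mk, W.sum_walks_succ]
  have h1 : ∑ i : Fin m, W.sectionCoeff u i * ∑ s ∈ W.walks n with ∑ i, s i = ((i : ℕ) : ℤ),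
        algebraMap F A (W.walkWeight s) =
      ∑ s ∈ W.walks n, algebraMap F A (W.walkWeight s) * u ^ (∑ i, s i) *
        ∑ k ∈ W.steps with ¬ 0 ≤ ∑ i, s i + k, algebraMap F A (W.weight k) * u ^ k := by
    simp only [Finset.mul_sum, Finset.sum_filter, mul_ite, mul_zero]
    rw [Finset.sum_comm]
    refine Finset.sum_congr rfl fun s hs => ?_
    obtain ⟨e, he⟩ := Int.eq_ofNat_of_zero_le (W.sum_nonneg_of_mem_walks hs)
    rw [he]
    by_cases hem : e < m
    · rw [Finset.sum_eq_single (⟨e, hem⟩ : Fin m)]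
      · rw [if_pos rfl, Model.sectionCoeff, Finset.sum_filter, Finset.sum_mul]
        refine Finset.sum_congr rfl fun k _ => ?_
        have : ((e : ℕ) : ℤ) < -k ↔ ¬ 0 ≤ (e : ℤ) + k := by omega
        simp only [this, zpow_natCast]
        split_ifs <;> ring
      · intro b _ hb
        rw [if_neg]
        intro h
        exact hb (Fin.ext (by simpa using h.symm))
      · simp
    · rw [Finset.sum_eq_zero, Finset.sum_eq_zero]
      · intro k hk
        have := hm k hk
        rw [if_neg (by omega)]
      · intro i _
        have := i.2
        rw [if_neg (by omega)]
  rw [h1, Finset.mul_sum, ← Finset.sum_sub_distrib]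
  refine Finset.sum_congr rfl fun s _ => ?_
  have h2 := Finset.sum_filter_add_sum_filter_not W.steps (fun k => 0 ≤ ∑ i, s i + k)
    (fun k => algebraMap F A (W.weight k) * u ^ k)
  rw [Model.S, ← h2]
  simp only [W.walkWeight_snoc, Fin.sum_univ_castSucc, Fin.snoc_castSucc, Fin.snoc_last,
    zpow_add₀ hu, map_mul]
  have h3 : ∀ a b c d : A, a * (b * c) = b * a * c := by intros; ring
  have : ∑ k ∈ W.steps with 0 ≤ ∑ i, s i + k,
      algebraMap F A (W.walkWeight s) * algebraMap F A (W.weight k) *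
        (u ^ (∑ i, s i) * u ^ k) =
      algebraMap F A (W.walkWeight s) * u ^ (∑ i, s i) *
        ∑ k ∈ W.steps with 0 ≤ ∑ i, s i + k, algebraMap F A (W.weight k) * u ^ k := by
    rw [Finset.mul_sum]
    exact Finset.sum_congr rfl fun k _ => by ring
  rw [this]
  ring

variable {W} in
theorem Model.K_mul_Q {m : ℕ} (hm : ∀ k ∈ W.steps, -(m : ℤ) ≤ k) {u : A} (hu : u ≠ 0) :
    W.K u * W.Q u = ∑ i : Fin m, -(PowerSeries.X * PowerSeries.C (W.sectionCoeff u i)) *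
      W.sectionGF A i + 1 := by
  ext n
  cases n with
  | zero =>
    simp only [Model.K, sub_mul, one_mul, mul_assoc, neg_mul, Finset.sum_neg_distrib]
    rw [← Finset.mul_sum]
    simp only [map_sub, map_add, map_neg, PowerSeries.coeff_zero_X_mul, W.coeff_zero_Q]
    simp
  | succ n =>
    simp only [Model.K, sub_mul, one_mul, mul_assoc, neg_mul, Finset.sum_neg_distrib]
    rw [← Finset.mul_sum]
    simp only [map_sub, map_add, map_neg, PowerSeries.coeff_succ_X_mul, map_sum,
      PowerSeries.coeff_C_mul, coeff_succ_Q hm hu]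
    simp [PowerSeries.coeff_one]

variable {W} in
-- `K` depends on its argument only through `S`, so `K(x)` may replace `K(u)` in `K_mul_Q`.
theorem Model.holds_orbitEquation {m : ℕ} (hm : ∀ k ∈ W.steps, -(m : ℤ) ≤ k) {x u : A}
    (hu : u ≠ 0) (hxu : W.S u = W.S x) : W.Holds (W.orbitEquation m x u) := by
  have hK : W.K x = W.K u := by rw [Model.K, Model.K, hxu]
  rw [Model.Holds, Model.orbitEquation, Finsupp.sum_single_index (by simp), hK]
  exact K_mul_Q hm hu

end Walks

/-! ### The kernel polynomial and the size of the orbit. -/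

section KernelPolynomial

open Polynomial

variable {F : Type*} [Field F] (W : Model F) {A : Type*} [Field A] [Algebra F A] {m M : ℕ}

/-- The polynomial `X ^ m * (S(X) - c)`. -/
def Model.kernelPoly (m : ℕ) (c : A) : A[X] :=
  ∑ i ∈ W.steps, monomial (i + m).toNat (algebraMap F A (W.weight i)) - monomial m c

variable {W}

theorem pow_mul_zpow_eq_pow_toNat {u : A} (hu : u ≠ 0) {i : ℤ} (hi : -(m : ℤ) ≤ i) :
    u ^ (i + m).toNat = u ^ m * u ^ i := by
  rw [← zpow_natCast, ← zpow_natCast, ← zpow_add₀ hu]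
  congr 1
  omega

theorem Model.eval_kernelPoly (hm : ∀ k ∈ W.steps, -(m : ℤ) ≤ k) (c : A) {u : A} (hu : u ≠ 0) :
    (W.kernelPoly m c).eval u = u ^ m * (W.S u - c) := by
  simp only [kernelPoly, eval_sub, eval_finsetSum, eval_monomial, Model.S, mul_sub,
    Finset.mul_sum]
  congr 1
  · refine Finset.sum_congr rfl fun i hi => ?_
    rw [pow_mul_zpow_eq_pow_toNat hu (hm i hi)]
    ring
  · ring

/-- The term of the product rule that differentiates `X ^ m` carries the factor `S(u) - c = 0`. -/
theorem Model.eval_derivative_kernelPoly (hm : ∀ k ∈ W.steps, -(m : ℤ) ≤ k) {c : A} {u : A}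
    (hu : u ≠ 0) (hc : W.S u = c) :
    (W.kernelPoly m c).derivative.eval u = u ^ m * W.S' u := by
  -- At `n = 0` the exponent `n - 1` is truncated, but the factor `n` makes both sides vanish.
  have key : ∀ (n : ℕ), (n : A) * u ^ (n - 1) = (n : A) * (u ^ n * u⁻¹) := by
    intro n
    cases n with
    | zero => simp
    | succ n => simp [pow_succ, hu]
  simp only [kernelPoly, derivative_sub, derivative_sum, derivative_monomial, eval_sub,
    eval_finsetSum, eval_monomial, mul_assoc, key]
  rw [← hc, Model.S, Finset.sum_mul, ← Finset.sum_sub_distrib, Model.S', Finset.mul_sum]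
  refine Finset.sum_congr rfl fun i hi => ?_
  have : (((i + m).toNat : ℕ) : A) = (i : A) + m := by
    have h : (((i + m).toNat : ℕ) : ℤ) = i + m := Int.toNat_of_nonneg (by linarith [hm i hi])
    exact_mod_cast congrArg (Int.cast : ℤ → A) h
  rw [this, pow_mul_zpow_eq_pow_toNat hu (hm i hi), zpow_sub_one₀ hu]
  ring

theorem Model.coeff_kernelPoly (hm : ∀ k ∈ W.steps, -(m : ℤ) ≤ k) (c : A) {i : ℤ}
    (hi : i ∈ W.steps) (him : i ≠ 0) :
    (W.kernelPoly m c).coeff (i + m).toNat = algebraMap F A (W.weight i) := by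
  have hi' := hm i hi
  simp only [kernelPoly, coeff_sub, finsetSum_coeff, coeff_monomial]
  rw [Finset.sum_eq_single i, if_pos rfl, if_neg (by omega), sub_zero]
  · intro b hb hbi
    have := hm b hb
    rw [if_neg (by omega)]
  · exact fun h => absurd hi h

theorem Model.natDegree_kernelPoly (hm : ∀ k ∈ W.steps, -(m : ℤ) ≤ k) (hM0 : 0 < M)
    (hM : IsGreatest (W.steps : Set ℤ) (M : ℤ)) (c : A) :
    (W.kernelPoly m c).natDegree = m + M ∧
      (W.kernelPoly m c).leadingCoeff = algebraMap F A (W.weight M) := by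
  have h1 : (W.kernelPoly m c).coeff (m + M) = algebraMap F A (W.weight M) := by
    have := Model.coeff_kernelPoly hm c hM.1 (by omega)
    rwa [show ((M : ℤ) + m).toNat = m + M by omega] at this
  have h2 : (W.kernelPoly m c).natDegree = m + M := by
    refine natDegree_eq_of_le_of_coeff_ne_zero ?_ ?_
    · rw [kernelPoly]
      refine (natDegree_sub_le _ _).trans (max_le ?_ ?_)
      · refine natDegree_sum_le_of_forall_le W.steps
          (fun i => monomial (i + m).toNat (algebraMap F A (W.weight i))) fun i hi => ?_
        refine le_trans (natDegree_monomial_le _) ?_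
        have := hM.2 hi
        omega
      · exact le_trans (natDegree_monomial_le _) (Nat.le_add_right m M)
    · rw [h1]
      simpa using W.weight_ne_zero _ hM.1
  exact ⟨h2, by rw [leadingCoeff, h2, h1]⟩

theorem Model.kernelPoly_ne_zero (hm : ∀ k ∈ W.steps, -(m : ℤ) ≤ k) (hM0 : 0 < M)
    (hM : IsGreatest (W.steps : Set ℤ) (M : ℤ)) (c : A) : W.kernelPoly m c ≠ 0 := by
  rw [← leadingCoeff_ne_zero, (natDegree_kernelPoly hm hM0 hM c).2]
  simpa using W.weight_ne_zero _ hM.1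

/-- The constant term is `w_{-m}` if `m > 0`. If `m = 0` it is an element of `F` minus `c`, and this
is where `c ∉ F` matters. -/
theorem Model.eval_zero_kernelPoly_ne_zero (hm : IsLeast (W.steps : Set ℤ) (-(m : ℤ))) {c : A}
    (hc : c ∉ Set.range (algebraMap F A)) : (W.kernelPoly m c).eval 0 ≠ 0 := by
  rw [← coeff_zero_eq_eval_zero]
  rcases Nat.eq_zero_or_pos m with rfl | h
  · simp only [kernelPoly, coeff_sub, finsetSum_coeff, coeff_monomial]
    rw [if_pos trivial, sub_ne_zero]
    intro h
    refine hc ⟨∑ b ∈ W.steps, if (b + (0 : ℕ)).toNat = 0 then W.weight b else 0, ?_⟩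
    rw [← h, map_sum]
    exact Finset.sum_congr rfl fun i _ => by split_ifs <;> simp
  · have := coeff_kernelPoly (fun k hk => hm.2 hk) c hm.1 (by omega)
    rw [show (-(m : ℤ) + m).toNat = 0 by omega] at this
    rw [this]
    simpa using W.weight_ne_zero _ hm.1

theorem Model.eval_kernelPoly_eq_zero_iff (hm : IsLeast (W.steps : Set ℤ) (-(m : ℤ))) {c : A}
    (hc : c ∉ Set.range (algebraMap F A)) {u : A} :
    (W.kernelPoly m c).eval u = 0 ↔ u ≠ 0 ∧ W.S u = c := by
  by_cases hu : u = 0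
  · subst hu
    simp [eval_zero_kernelPoly_ne_zero hm hc]
  · rw [eval_kernelPoly (fun k hk => hm.2 hk) c hu]
    simp [hu, sub_eq_zero]

theorem Model.map_S {B : Type*} [Field B] [Algebra F B] (φ : A →ₐ[F] B) (a : A) :
    W.S (φ a) = φ (W.S a) := by
  simp [Model.S, map_sum]

theorem mem_range_algebraMap_of_isAlgebraic [IsAlgClosed F] {u : A} (hu : IsAlgebraic F u) :
    u ∈ Set.range (algebraMap F A) := by
  have h := IsAlgClosed.degree_eq_one_of_irreducible F (minpoly.irreducible hu.isIntegral)
  exact minpoly.mem_range_of_degree_eq_one F u h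

theorem Model.S_notMem_range [IsAlgClosed F] (hm : ∀ k ∈ W.steps, -(m : ℤ) ≤ k) (hM0 : 0 < M)
    (hM : IsGreatest (W.steps : Set ℤ) (M : ℤ)) {x : A} (hx : x ∉ Set.range (algebraMap F A)) :
    W.S x ∉ Set.range (algebraMap F A) := by
  rintro ⟨a, ha⟩
  have hx0 : x ≠ 0 := fun h => hx ⟨0, by simp [h]⟩
  refine hx (mem_range_algebraMap_of_isAlgebraic
    ⟨W.kernelPoly m a, kernelPoly_ne_zero hm hM0 hM a, ?_⟩)
  have : (W.kernelPoly m a).map (algebraMap F A) = W.kernelPoly m (W.S x) := by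
    simp [kernelPoly, Polynomial.map_sum, ha]
  rw [aeval_def, eval₂_eq_eval_map, this, eval_kernelPoly hm _ hx0]
  simp

/-- `X ^ (m + 1) S'(X)` is a polynomial over `F`, nonzero because its coefficient of degree `M + m`
is `M w_M` and the characteristic is `0`. Its roots in `A` are algebraic over `F`, hence in `F`. -/
theorem Model.S'_ne_zero [IsAlgClosed F] [CharZero F] (hm : ∀ k ∈ W.steps, -(m : ℤ) ≤ k)
    (hM0 : 0 < M) (hM : IsGreatest (W.steps : Set ℤ) (M : ℤ)) {u : A}
    (hu : u ∉ Set.range (algebraMap F A)) : W.S' u ≠ 0 := by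
  intro h
  have hu0 : u ≠ 0 := fun h => hu ⟨0, by simp [h]⟩
  refine hu (mem_range_algebraMap_of_isAlgebraic
    ⟨∑ i ∈ W.steps, monomial (i + m).toNat ((i : F) * W.weight i), ?_, ?_⟩)
  · intro h0
    have := congrArg (fun p => coeff p (M + m)) h0
    simp only [finsetSum_coeff, coeff_monomial, coeff_zero] at this
    rw [Finset.sum_eq_single (M : ℤ), if_pos (by omega)] at this
    · exact mul_ne_zero (by exact_mod_cast hM0.ne') (W.weight_ne_zero _ hM.1) this
    · intro b hb hbM
      have := hm b hb
      rw [if_neg (by omega)]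
    · exact fun h => absurd hM.1 h
  · have : W.S' u * u ^ (m + 1) = 0 := by rw [h, zero_mul]
    rw [map_sum, ← this, Model.S', Finset.sum_mul]
    refine Finset.sum_congr rfl fun i hi => ?_
    rw [aeval_monomial, pow_mul_zpow_eq_pow_toNat hu0 (hm i hi), zpow_sub_one₀ hu0, pow_succ]
    field_simp
    simp

theorem Model.setOf_S_eq (hm : IsLeast (W.steps : Set ℤ) (-(m : ℤ))) (hM0 : 0 < M)
    (hM : IsGreatest (W.steps : Set ℤ) (M : ℤ)) {c : A} (hc : c ∉ Set.range (algebraMap F A)) :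
    {u : A | u ≠ 0 ∧ W.S u = c} = {u | u ∈ (W.kernelPoly m c).roots} := by
  ext u
  rw [Set.mem_ofPred_eq, Set.mem_ofPred_eq,
    mem_roots (kernelPoly_ne_zero (fun k hk => hm.2 hk) hM0 hM c), IsRoot,
    eval_kernelPoly_eq_zero_iff hm hc]

/-- Only the degree is used, so the bound applies to Puiseux series without knowing that their field
is algebraically closed. -/
theorem Model.encard_setOf_S_eq_le (hm : IsLeast (W.steps : Set ℤ) (-(m : ℤ))) (hM0 : 0 < M)
    (hM : IsGreatest (W.steps : Set ℤ) (M : ℤ)) {c : A} (hc : c ∉ Set.range (algebraMap F A)) :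
    {u : A | u ≠ 0 ∧ W.S u = c}.encard ≤ m + M := by
  classical
  rw [setOf_S_eq hm hM0 hM hc]
  have h1 : {u | u ∈ (W.kernelPoly m c).roots} = ((W.kernelPoly m c).roots.toFinset : Set A) := by
    ext; simp
  rw [h1, Set.encard_coe_eq_coe_finsetCard]
  have := (Multiset.toFinset_card_le (W.kernelPoly m c).roots).trans (card_roots' _)
  rw [(natDegree_kernelPoly (fun k hk => hm.2 hk) hM0 hM c).1] at this
  exact_mod_cast this

/-- A multiple root `u` satisfies `S'(u) = 0`, so `u` lies in `F`, and then so does `c = S(u)`. -/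
theorem Model.nodup_roots_kernelPoly [IsAlgClosed F] [CharZero F]
    (hm : IsLeast (W.steps : Set ℤ) (-(m : ℤ))) (hM0 : 0 < M)
    (hM : IsGreatest (W.steps : Set ℤ) (M : ℤ)) {c : A} (hc : c ∉ Set.range (algebraMap F A)) :
    (W.kernelPoly m c).roots.Nodup := by
  classical
  have hm' : ∀ k ∈ W.steps, -(m : ℤ) ≤ k := fun k hk => hm.2 hk
  rw [Multiset.nodup_iff_count_le_one]
  intro u
  rw [count_roots]
  by_contra! h
  rw [one_lt_rootMultiplicity_iff_isRoot (kernelPoly_ne_zero hm' hM0 hM c)] at h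
  obtain ⟨hu0, hu⟩ := (eval_kernelPoly_eq_zero_iff hm hc).1 h.1
  have h2 := h.2
  rw [IsRoot, eval_derivative_kernelPoly hm' hu0 hu] at h2
  refine S'_ne_zero hm' hM0 hM ?_ ((mul_eq_zero.1 h2).resolve_left (pow_ne_zero _ hu0))
  rintro ⟨a, rfl⟩
  refine hc ⟨W.S a, ?_⟩
  rw [← hu]
  exact (map_S (Algebra.ofId F A) a).symm

theorem Model.encard_setOf_S_eq [IsAlgClosed F] [CharZero F] [IsAlgClosed A]
    (hm : IsLeast (W.steps : Set ℤ) (-(m : ℤ))) (hM0 : 0 < M)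
    (hM : IsGreatest (W.steps : Set ℤ) (M : ℤ)) {c : A} (hc : c ∉ Set.range (algebraMap F A)) :
    {u : A | u ≠ 0 ∧ W.S u = c}.encard = m + M := by
  classical
  rw [setOf_S_eq hm hM0 hM hc]
  have h1 : {u | u ∈ (W.kernelPoly m c).roots} = ((W.kernelPoly m c).roots.toFinset : Set A) := by
    ext; simp
  rw [h1, Set.encard_coe_eq_coe_finsetCard,
    Multiset.toFinset_card_of_nodup (nodup_roots_kernelPoly hm hM0 hM hc),
    ← (IsAlgClosed.splits _).natDegree_eq_card_roots,
    (natDegree_kernelPoly (fun k hk => hm.2 hk) hM0 hM c).1]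
  simp

/-- Any two distinct points of the level set are adjacent, so one step reaches the whole orbit. -/
theorem Model.orbit_eq {x : A} (hx : x ≠ 0) : W.orbit x = {u | u ≠ 0 ∧ W.S u = W.S x} := by
  ext u
  constructor
  · intro h
    induction h with
    | refl => exact ⟨hx, rfl⟩
    | tail _ h ih => exact ⟨h.2.1, h.2.2.2 ▸ ih.2⟩
  · rintro ⟨hu, h⟩
    by_cases hxu : x = u
    · exact hxu ▸ Relation.ReflTransGen.refl
    · exact Relation.ReflTransGen.single ⟨hx, hu, hxu, h.symm⟩

end KernelPolynomial

/-! ### Divided differences and functionals killing low-degree polynomials. -/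

section DividedDifferences

open Polynomial

variable {A : Type*} [Field A] {m : ℕ}

/-- The sum is the coefficient of `X ^ m` in the Lagrange interpolation of `X ^ l` at the `u i`,
which is `X ^ l` itself. -/
theorem sum_pow_div_prod_sub {u : Fin (m + 1) → A} (hu : Function.Injective u) {l : ℕ}
    (hl : l ≤ m) :
    ∑ i, u i ^ l / ∏ j ∈ Finset.univ.erase i, (u i - u j) = if l = m then 1 else 0 := by
  have h := Lagrange.coeff_eq_sum (s := Finset.univ) (v := u) hu.injOn (P := (X : A[X]) ^ l) (by
    rw [degree_X_pow]
    rw [Finset.card_univ, Fintype.card_fin]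
    exact_mod_cast Nat.lt_succ_of_le hl)
  simp only [Finset.card_univ, Fintype.card_fin, Nat.add_sub_cancel, eval_pow, eval_X,
    coeff_X_pow] at h
  rw [← h]
  exact if_congr eq_comm rfl rfl

/-- The divided difference at the points `u 0, …, u m`, as a linear combination of evaluations. -/
def dividedDifference (u : Fin (m + 1) → A) : A →₀ A :=
  ∑ i, Finsupp.single (u i) (∏ j ∈ Finset.univ.erase i, (u i - u j))⁻¹

theorem sum_dividedDifference_pow {u : Fin (m + 1) → A} (hu : Function.Injective u) {l : ℕ}
    (hl : l < m) : Finsupp.linearCombination A (fun v : A => v ^ l) (dividedDifference u) = 0 := by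
  simp only [dividedDifference, map_sum, Finsupp.linearCombination_single, smul_eq_mul]
  have := sum_pow_div_prod_sub hu hl.le
  rw [if_neg hl.ne] at this
  rw [← this]
  exact Finset.sum_congr rfl fun i _ => by rw [div_eq_mul_inv, mul_comm]

theorem dividedDifference_apply_ne_zero {u : Fin (m + 1) → A} (hu : Function.Injective u)
    (i : Fin (m + 1)) : dividedDifference u (u i) ≠ 0 := by
  classical
  rw [dividedDifference, Finsupp.finsetSum_apply, Finset.sum_eq_single i, Finsupp.single_eq_same]
  · refine inv_ne_zero (Finset.prod_ne_zero_iff.2 fun j hj => sub_ne_zero.2 fun h => ?_)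
    exact Finset.ne_of_mem_erase hj (hu h).symm
  · intro j _ hj
    rw [Finsupp.single_apply, if_neg fun h => hj (hu h)]
  · simp

theorem dividedDifference_apply_eq_zero {u : Fin (m + 1) → A} {a : A} (ha : ∀ i, u i ≠ a) :
    dividedDifference u a = 0 := by
  classical
  rw [dividedDifference, Finsupp.finsetSum_apply]
  exact Finset.sum_eq_zero fun i _ => by rw [Finsupp.single_apply, if_neg (ha i)]

theorem sum_mul_eval_eq_zero {b : A →₀ A}
    (hb : ∀ l < m, Finsupp.linearCombination A (fun v : A => v ^ l) b = 0) {P : A[X]}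
    (hP : P.natDegree < m) : ∑ v ∈ b.support, b v * P.eval v = 0 := by
  simp only [eval_eq_sum_range' hP, Finset.mul_sum]
  rw [Finset.sum_comm]
  refine Finset.sum_eq_zero fun l hl => ?_
  have := hb l (Finset.mem_range.1 hl)
  rw [Finsupp.linearCombination_apply, Finsupp.sum] at this
  rw [← mul_zero (P.coeff l), ← this, Finset.mul_sum]
  exact Finset.sum_congr rfl fun v _ => by rw [smul_eq_mul]; ring

/-- With at most `m` points in the support, the product of `X - w` over all of them but one has
degree less than `m`, and the functional applied to it isolates one nonzero weight. -/
theorem card_support_of_moments_eq_zero {b : A →₀ A}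
    (hb : ∀ l < m, Finsupp.linearCombination A (fun v : A => v ^ l) b = 0) (hb0 : b ≠ 0) :
    m + 1 ≤ b.support.card := by
  classical
  by_contra! h
  obtain ⟨v, hv⟩ := Finsupp.support_nonempty_iff.2 hb0
  have hcard : 0 < b.support.card := Finset.card_pos.2 ⟨v, hv⟩
  have hP : (∏ w ∈ b.support.erase v, (X - C w)).natDegree < m := by
    rw [natDegree_finsetProd_X_sub_C_eq_card, Finset.card_erase_of_mem hv]
    omega
  have h0 := sum_mul_eval_eq_zero hb hP
  rw [Finset.sum_eq_single v] at h0
  · rw [eval_prod] at h0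
    refine (mul_ne_zero (Finsupp.mem_support_iff.1 hv) (Finset.prod_ne_zero_iff.2 ?_)) h0
    intro w hw
    simpa [sub_ne_zero] using (Finset.ne_of_mem_erase hw).symm
  · intro w hw hwv
    rw [eval_prod, Finset.prod_eq_zero (Finset.mem_erase.2 ⟨hwv, hw⟩) (by simp), mul_zero]
  · exact fun h => absurd hv h

/-- A linear combination of evaluations that kills the polynomials of degree less than `m` is a
linear combination of divided differences of order `m`. -/
theorem mem_span_dividedDifference (O : Set A) (b : A →₀ A) (hO : ∀ v ∈ b.support, v ∈ O)
    (hb : ∀ l < m, Finsupp.linearCombination A (fun v : A => v ^ l) b = 0) :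
    b ∈ Submodule.span A {c | ∃ u : Fin (m + 1) → A, Function.Injective u ∧ (∀ i, u i ∈ O) ∧
      c = dividedDifference u} := by
  classical
  induction hn : b.support.card using Nat.strong_induction_on generalizing b with
  | _ n ih =>
    by_cases hb0 : b = 0
    · rw [hb0]
      exact Submodule.zero_mem _
    obtain ⟨T, hT, hTc⟩ := Finset.exists_subset_card_eq (card_support_of_moments_eq_zero hb hb0)
    let e : Fin (m + 1) ≃ T := (T.equivFinOfCardEq hTc).symm
    let u : Fin (m + 1) → A := fun i => e i
    have hu : Function.Injective u := Subtype.val_injective.comp e.injective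
    have huT : ∀ i, u i ∈ b.support := fun i => hT (e i).2
    -- Subtracting this multiple of a divided difference supported inside the support of `b` kills
    -- the weight at `u 0`, so the support shrinks strictly.
    set r := b (u 0) / dividedDifference u (u 0) with hr
    have hmem : r • dividedDifference u ∈ Submodule.span A
        {c | ∃ u : Fin (m + 1) → A, Function.Injective u ∧ (∀ i, u i ∈ O) ∧
          c = dividedDifference u} :=
      Submodule.smul_mem _ _ (Submodule.subset_span ⟨u, hu, fun i => hO _ (huT i), rfl⟩)
    have hsub : (b - r • dividedDifference u).support ⊆ b.support.erase (u 0) := by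
      intro v hv
      rw [Finsupp.mem_support_iff, Finsupp.sub_apply, Finsupp.smul_apply, smul_eq_mul] at hv
      refine Finset.mem_erase.2 ⟨?_, ?_⟩
      · rintro rfl
        exact hv (by rw [hr, div_mul_cancel₀ _ (dividedDifference_apply_ne_zero hu 0), sub_self])
      · by_contra hvb
        refine hv ?_
        rw [Finsupp.notMem_support_iff.1 hvb,
          dividedDifference_apply_eq_zero fun i (h : u i = v) => hvb (h ▸ huT i)]
        simp
    have := ih _ (by
      rw [← hn]
      exact (Finset.card_le_card hsub).trans_lt (Finset.card_erase_lt_of_mem (huT 0)))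
      (b - r • dividedDifference u) (fun v hv => hO v (Finset.mem_of_mem_erase (hsub hv)))
      (fun l hl => by rw [map_sub, map_smul, hb l hl, sum_dividedDifference_pow hu hl]; simp) rfl
    simpa using Submodule.add_mem _ this hmem

end DividedDifferences

/-! ### The space of section-free equations. -/

section SectionFree

variable {F : Type*} [Field F] {W : Model F} {A : Type*} [Field A] [Algebra F A] {m : ℕ}

theorem sum_lagrangeCoeff {u : Fin (m + 1) → A} (hu : Function.Injective u) :
    ∑ i, lagrangeCoeff u i = 1 := by
  have := sum_pow_div_prod_sub hu le_rfl
  rwa [if_pos rfl] at this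

/-- `u ^ m` times the section coefficient is a polynomial in `u` of degree less than `m`, since `k +
p < 0`; the divided difference kills it. -/
theorem sum_lagrangeCoeff_mul_sectionCoeff (hm : ∀ k ∈ W.steps, -(m : ℤ) ≤ k)
    {u : Fin (m + 1) → A} (hu : Function.Injective u) (hu0 : ∀ i, u i ≠ 0) (p : ℕ) :
    ∑ i, lagrangeCoeff u i * W.sectionCoeff (u i) p = 0 := by
  simp only [Model.sectionCoeff, Finset.mul_sum]
  rw [Finset.sum_comm]
  refine Finset.sum_eq_zero fun k hk => ?_
  rw [Finset.mem_filter] at hk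
  have hkm := hm k hk.1
  have hl : (k + m).toNat + p < m := by omega
  have := sum_pow_div_prod_sub hu hl.le
  rw [if_neg hl.ne] at this
  rw [← mul_zero (algebraMap F A (W.weight k)), ← this, Finset.mul_sum]
  refine Finset.sum_congr rfl fun i _ => ?_
  rw [lagrangeCoeff, pow_add, pow_mul_zpow_eq_pow_toNat (hu0 i) hkm]
  ring

theorem Model.K_mul_sum_lagrangeCoeff (hm : ∀ k ∈ W.steps, -(m : ℤ) ≤ k) {x : A}
    {u : Fin (m + 1) → A} (hu : Function.Injective u) (hu0 : ∀ i, u i ≠ 0)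
    (hux : ∀ i, W.S (u i) = W.S x) :
    W.K x * ∑ i, PowerSeries.C (lagrangeCoeff u i) * W.Q (u i) = 1 := by
  have h1 : ∀ i, W.K x * (PowerSeries.C (lagrangeCoeff u i) * W.Q (u i)) =
      -(PowerSeries.X * ∑ p : Fin m, PowerSeries.C (lagrangeCoeff u i * W.sectionCoeff (u i) p) *
        W.sectionGF A p) + PowerSeries.C (lagrangeCoeff u i) := by
    intro i
    have hK : W.K x = W.K (u i) := by rw [Model.K, Model.K, hux]
    rw [mul_left_comm, hK, K_mul_Q hm (hu0 i), mul_add, mul_one, Finset.mul_sum, Finset.mul_sum,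
      ← Finset.sum_neg_distrib]
    congr 1
    refine Finset.sum_congr rfl fun p _ => ?_
    rw [map_mul]
    ring
  rw [Finset.mul_sum, Finset.sum_congr rfl fun i _ => h1 i, Finset.sum_add_distrib, ← map_sum,
    sum_lagrangeCoeff hu, Finset.sum_neg_distrib, ← Finset.mul_sum, Finset.sum_comm,
    Finset.sum_eq_zero]
  · simp
  · intro p _
    rw [← Finset.sum_mul, ← map_sum, sum_lagrangeCoeff_mul_sectionCoeff hm hu hu0]
    simp

theorem Model.sum_smul_orbitEquation_fst (m : ℕ) (x : A) (a : A →₀ A) :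
    (Finsupp.linearCombination A (W.orbitEquation m x) a).2.1 = fun i : Fin m =>
      -(PowerSeries.X * PowerSeries.C
        (Finsupp.linearCombination A (fun u => W.sectionCoeff u i) a)) := by
  funext i
  induction a using Finsupp.induction_linear with
  | zero => simp
  | add f g hf hg =>
    simp only [map_add, Prod.snd_add, Prod.fst_add, Pi.add_apply, hf, hg]
    ring
  | single u c =>
    simp only [Finsupp.linearCombination_single, Prod.smul_snd, Prod.smul_fst, Pi.smul_apply,
      Model.orbitEquation, smul_eq_mul, PowerSeries.smul_eq_C_mul, map_mul]
    rw [Model.sectionCoeff]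
    ring

/-- The lagrange equation as a combination of orbit equations. -/
theorem Model.lagrangeEquation_eq (hm : ∀ k ∈ W.steps, -(m : ℤ) ≤ k) (x : A)
    {u : Fin (m + 1) → A} (hu : Function.Injective u) (hu0 : ∀ i, u i ≠ 0) :
    W.lagrangeEquation x u = ∑ i, lagrangeCoeff u i • W.orbitEquation m x (u i) := by
  refine Prod.ext ?_ (Prod.ext ?_ ?_)
  · simp [lagrangeEquation, orbitEquation, Prod.fst_sum, PowerSeries.smul_eq_C_mul, mul_comm]
  · have h := W.sum_smul_orbitEquation_fst m x
      (∑ i, Finsupp.single (u i) (lagrangeCoeff u i))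
    simp only [map_sum, Finsupp.linearCombination_single] at h
    rw [h]
    funext p
    simp only [smul_eq_mul, ← map_sum, sum_lagrangeCoeff_mul_sectionCoeff hm hu hu0]
    simp [lagrangeEquation]
  · simp only [lagrangeEquation, orbitEquation, Prod.snd_sum, Prod.smul_snd,
      PowerSeries.smul_eq_C_mul, mul_one]
    rw [← map_sum, sum_lagrangeCoeff hu, map_one]

theorem lagrangeCoeff_smul_eq (u : Fin (m + 1) → A) {E : Type*} [AddCommGroup E] [Module A E]
    (f : A → E) : ∑ i, lagrangeCoeff u i • f (u i) =
      Finsupp.linearCombination A (fun v => v ^ m • f v) (dividedDifference u) := by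
  simp only [dividedDifference, map_sum, Finsupp.linearCombination_single, smul_smul]
  exact Finset.sum_congr rfl fun i _ => by rw [lagrangeCoeff, div_eq_mul_inv, mul_comm]

/-- If no section occurs in a combination of orbit equations, its negative moments vanish. -/
theorem Model.moments_eq_zero (hm : IsLeast (W.steps : Set ℤ) (-(m : ℤ))) {a : A →₀ A}
    (ha0 : ∀ v ∈ a.support, v ≠ 0)
    (ha : ∀ i < m, Finsupp.linearCombination A (fun u => W.sectionCoeff u i) a = 0) (j : ℕ)
    (hj0 : 0 < j) (hjm : j ≤ m) :
    Finsupp.linearCombination A (fun v : A => v ^ (-(j : ℤ))) a = 0 := by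
  induction j using Nat.strong_induction_on with
  | _ j ih =>
    -- In the coefficient of `Q_{m-j}` the exponents `k + m - j` run from `-j` to `-1`. Exponent
    -- `-j` occurs only for `k = -m`, with weight `w_{-m} ≠ 0`; the others are covered by induction.
    have h := ha (m - j) (by omega)
    have h1 : Finsupp.linearCombination A (fun u => W.sectionCoeff u (m - j)) a =
        ∑ k ∈ W.steps with ((m - j : ℕ) : ℤ) < -k, algebraMap F A (W.weight k) *
          Finsupp.linearCombination A (fun v : A => v ^ (k + (m - j : ℕ))) a := by
      simp only [Finsupp.linearCombination_apply, Finsupp.sum, Finset.mul_sum, smul_eq_mul,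
        Model.sectionCoeff]
      rw [Finset.sum_comm]
      refine Finset.sum_congr rfl fun k _ => Finset.sum_congr rfl fun v hv => ?_
      rw [zpow_add₀ (ha0 v hv), zpow_natCast]
      ring
    rw [h1, Finset.sum_eq_single (-(m : ℤ))] at h
    · rw [show -(m : ℤ) + (m - j : ℕ) = -(j : ℤ) by omega] at h
      exact (mul_eq_zero.1 h).resolve_left (by simpa using W.weight_ne_zero _ hm.1)
    · intro k hk hkm
      rw [Finset.mem_filter] at hk
      have := hm.2 hk.1
      have h2 := ih (j - (k + m).toNat) (by omega) (by omega) (by omega)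
      rw [show -((j - (k + m).toNat : ℕ) : ℤ) = k + (m - j : ℕ) by omega] at h2
      rw [h2, mul_zero]
    · intro hn
      refine absurd (Finset.mem_filter.2 ⟨hm.1, ?_⟩) hn
      omega

theorem Model.sectionFree_eq_span (hm : IsLeast (W.steps : Set ℤ) (-(m : ℤ))) {x : A}
    (hx : x ≠ 0) :
    W.sectionFree m x = Submodule.span A
      {e | ∃ u : Fin (m + 1) → A, Function.Injective u ∧ (∀ i, u i ∈ W.orbit x) ∧
        e = W.lagrangeEquation x u} := by
  have hm' : ∀ k ∈ W.steps, -(m : ℤ) ≤ k := fun k hk => hm.2 hk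
  have hO : ∀ v ∈ W.orbit x, v ≠ 0 := fun v hv => by
    rw [orbit_eq hx] at hv
    exact hv.1
  apply le_antisymm
  · rintro e ⟨he, hk⟩
    have himg : {e | ∃ u ∈ W.orbit x, e = W.orbitEquation m x u} =
        W.orbitEquation m x '' W.orbit x := by
      ext e
      simp [eq_comm]
    rw [himg] at he
    obtain ⟨a, ha, rfl⟩ := (Finsupp.mem_span_image_iff_linearCombination A).1 he
    have haO : ∀ v ∈ a.support, v ∈ W.orbit x := fun v hv =>
      (Finsupp.mem_supported A a).1 ha hv
    have hk' : (Finsupp.linearCombination A (W.orbitEquation m x) a).2.1 = 0 := hk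
    rw [sum_smul_orbitEquation_fst] at hk'
    have hsec : ∀ i < m, Finsupp.linearCombination A (fun u => W.sectionCoeff u i) a = 0 := by
      intro i hi
      have h := congrFun hk' ⟨i, hi⟩
      simpa [PowerSeries.X_ne_zero] using h
    have hmom := moments_eq_zero hm (fun v hv => hO v (haO v hv)) hsec
    -- Dividing the weights by `v ^ m` turns the moments of order `-m, …, -1` into those of order
    -- `0, …, m - 1`.
    let b : A →₀ A := Finsupp.onFinset a.support (fun v => a v * (v ^ m)⁻¹)
      fun v hv => Finsupp.mem_support_iff.2 (left_ne_zero_of_mul hv)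
    have hbsupp : b.support ⊆ a.support := Finsupp.support_onFinset_subset
    have hb : ∀ {E : Type _} [AddCommGroup E] [Module A E] (f : A → E),
        Finsupp.linearCombination A f b = ∑ v ∈ a.support, (a v * (v ^ m)⁻¹) • f v := by
      intro E _ _ f
      rw [Finsupp.linearCombination_apply,
        Finsupp.sum_of_support_subset b hbsupp (fun v c => c • f v) fun _ _ => zero_smul A _]
      rfl
    have hba : Finsupp.linearCombination A (W.orbitEquation m x) a =
        Finsupp.linearCombination A (fun v => v ^ m • W.orbitEquation m x v) b := by
      rw [hb, Finsupp.linearCombination_apply, Finsupp.sum]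
      refine Finset.sum_congr rfl fun v hv => ?_
      rw [smul_smul, inv_mul_cancel_right₀ (pow_ne_zero _ (hO v (haO v hv)))]
    have hbspan := mem_span_dividedDifference (m := m) (W.orbit x) b
      (fun v hv => haO v (hbsupp hv)) fun l hl => by
        have h := hmom (m - l) (by omega) (by omega)
        rw [Finsupp.linearCombination_apply, Finsupp.sum] at h
        rw [hb, ← h]
        refine Finset.sum_congr rfl fun v hv => ?_
        have hv0 := hO v (haO v hv)
        rw [zpow_neg, zpow_natCast, ← Nat.sub_add_cancel hl.le, pow_add, Nat.add_sub_cancel]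
        simp only [smul_eq_mul]
        field_simp
    rw [hba]
    have := Submodule.mem_map_of_mem
      (f := Finsupp.linearCombination A fun v => v ^ m • W.orbitEquation m x v) hbspan
    rw [Submodule.map_span] at this
    refine Submodule.span_mono ?_ this
    rintro _ ⟨_, ⟨u, hu, huO, rfl⟩, rfl⟩
    refine ⟨u, hu, huO, ?_⟩
    rw [lagrangeEquation_eq hm' x hu fun i => hO _ (huO i),
      lagrangeCoeff_smul_eq u (W.orbitEquation m x)]
  · refine Submodule.span_le.2 ?_
    rintro _ ⟨u, hu, huO, rfl⟩
    refine ⟨?_, rfl⟩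
    rw [lagrangeEquation_eq hm' x hu fun i => hO _ (huO i)]
    exact Submodule.sum_mem _ fun i _ => Submodule.smul_mem _ _
      (Submodule.subset_span ⟨u i, huO i, rfl⟩)

end SectionFree

/-! ### Coefficients of `Q` on the orbit, modulo polynomials of degree less than `m`. -/

section SmallRoots

open Polynomial

variable {F : Type*} [Field F] {W : Model F} {A : Type*} [Field A] [Algebra F A] {m : ℕ}

theorem Model.coeff_inv_K (x : A) (n : ℕ) : PowerSeries.coeff n (W.K x)⁻¹ = W.S x ^ n := by
  have h : (W.K x)⁻¹ = PowerSeries.mk fun n => W.S x ^ n := by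
    symm
    rw [PowerSeries.eq_inv_iff_mul_eq_one (by simp [Model.K])]
    ext n
    cases n with
    | zero => simp [Model.K, mul_sub]
    | succ n =>
      rw [Model.K, mul_sub, mul_one, mul_left_comm, map_sub, PowerSeries.coeff_succ_X_mul,
        PowerSeries.coeff_mul_C]
      simp [pow_succ, PowerSeries.coeff_one]
  rw [h, PowerSeries.coeff_mk]

/-- At the points of the orbit of `x`, the polynomial `u ^ m * [t ^ n] Q(u)` coincides with
`S(x) ^ n * D(u)` up to a polynomial of degree less than `m`, for `D` monic of degree `m`. -/
theorem Model.exists_pow_mul_coeff_Q_eq (hm : ∀ k ∈ W.steps, -(m : ℤ) ≤ k) (c : A) {D : A[X]}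
    (hD : D.Monic) (hDm : D.natDegree = m) (n : ℕ) :
    ∃ B : A[X], B.degree < m ∧ ∀ u : A, u ≠ 0 → W.S u = c →
      u ^ m * PowerSeries.coeff n (W.Q u) = c ^ n * D.eval u + B.eval u := by
  induction n with
  | zero =>
    -- The coefficient `[t ^ 0] Q` is `1`, and the two monic polynomials of degree `m` differ by
    -- lower-degree terms.
    refine ⟨X ^ m - D, ?_, ?_⟩
    · have hd : D.degree = m := by rw [degree_eq_natDegree hD.ne_zero, hDm]
      have := degree_sub_lt_left (p := (X : A[X]) ^ m) (q := D) (by rw [degree_X_pow, hd])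
        (monic_X_pow m).ne_zero (by rw [hD.leadingCoeff, (monic_X_pow m).leadingCoeff])
      rwa [degree_X_pow] at this
    · intro u _ _
      simp [W.coeff_zero_Q]
  | succ n ih =>
    obtain ⟨B, hB, h⟩ := ih
    refine ⟨C c * B - ∑ i : Fin m, ∑ k ∈ W.steps with ((i : ℕ) : ℤ) < -k,
      monomial ((k + m).toNat + i)
        (algebraMap F A (W.weight k) * PowerSeries.coeff n (W.sectionGF A i)), ?_, ?_⟩
    · refine (degree_sub_le _ _).trans_lt (max_lt ?_ ?_)
      · refine lt_of_le_of_lt ?_ hB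
        rw [← smul_eq_C_mul]
        exact degree_smul_le c B
      · refine (degree_sum_le _ _).trans_lt ((Finset.sup_lt_iff (WithBot.bot_lt_coe m)).2 ?_)
        intro i _
        refine (degree_sum_le _ _).trans_lt ((Finset.sup_lt_iff (WithBot.bot_lt_coe m)).2 ?_)
        intro k hk
        rw [Finset.mem_filter] at hk
        have := hm k hk.1
        refine (degree_monomial_le _ _).trans_lt ?_
        exact Nat.cast_lt.2 (by omega)
    · intro u hu huc
      have hG : u ^ m * ∑ i : Fin m, W.sectionCoeff u i * PowerSeries.coeff n (W.sectionGF A i) =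
          eval u (∑ i : Fin m, ∑ k ∈ W.steps with ((i : ℕ) : ℤ) < -k,
            monomial ((k + m).toNat + i)
              (algebraMap F A (W.weight k) * PowerSeries.coeff n (W.sectionGF A i))) := by
        simp only [eval_finsetSum, eval_monomial, Model.sectionCoeff, Finset.mul_sum,
          Finset.sum_mul]
        refine Finset.sum_congr rfl fun i _ => Finset.sum_congr rfl fun k hk => ?_
        rw [pow_add, pow_mul_zpow_eq_pow_toNat hu (hm k (Finset.mem_filter.1 hk).1)]
        ring
      rw [coeff_succ_Q hm hu, mul_sub, hG, eval_sub, eval_mul, eval_C, huc, mul_left_comm, h u hu huc]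
      ring

/-- If the roots of `D` and the scalars lie in a subring `V`, then the polynomial of degree less
than `m` in `exists_pow_mul_coeff_Q_eq` has its coefficients in `V`. -/
theorem Model.exists_pow_mul_coeff_Q_eq_subring (hm : ∀ k ∈ W.steps, -(m : ℤ) ≤ k) (V : Subring A)
    (hV : ∀ a : F, algebraMap F A a ∈ V) {x : A} (hx : x ≠ 0) {ξ : Fin m → A}
    (hξ : Function.Injective ξ) (hξ0 : ∀ j, ξ j ≠ 0) (hξS : ∀ j, W.S (ξ j) = W.S x)
    (hξV : ∀ j, ξ j ∈ V) (n : ℕ) :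
    ∃ B : A[X], B.degree < m ∧ (∀ k, B.coeff k ∈ V) ∧
      x ^ m * PowerSeries.coeff n (W.Q x) = W.S x ^ n * ∏ j, (x - ξ j) + B.eval x := by
  let DV : V[X] := ∏ j, (X - C ⟨ξ j, hξV j⟩)
  have hDV : DV.Monic := monic_prod_of_monic _ _ fun j _ => monic_X_sub_C _
  have hmap : DV.map V.subtype = ∏ j, (X - C (ξ j)) := by
    simp [DV, Polynomial.map_prod]
  have hdeg : DV.natDegree = m := by
    rw [natDegree_finsetProd_X_sub_C_eq_card]
    simp
  obtain ⟨B, hB, h⟩ := exists_pow_mul_coeff_Q_eq hm (W.S x) (hDV.map V.subtype)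
    ((hDV.natDegree_map _).trans hdeg) n
  -- `H(u) = u ^ m [t ^ n] Q(u)`. Dividing by the monic `DV` over `V` keeps the coefficients of the
  -- remainder in `V`.
  let H : V[X] := ∑ s ∈ W.walks n, monomial (m + (∑ i, s i).toNat)
    ⟨algebraMap F A (W.walkWeight s), hV _⟩
  have hH : ∀ u : A, eval u (H.map V.subtype) = u ^ m * PowerSeries.coeff n (W.Q u) := by
    intro u
    simp only [H, Polynomial.map_sum, Polynomial.map_monomial, eval_finsetSum, eval_monomial,
      Model.Q, PowerSeries.coeff_mk, Finset.mul_sum]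
    refine Finset.sum_congr rfl fun s hs => ?_
    obtain ⟨e, he⟩ := Int.eq_ofNat_of_zero_le (W.sum_nonneg_of_mem_walks hs)
    rw [he, pow_add]
    simp only [Int.toNat_natCast, zpow_natCast, Subring.subtype_apply]
    ring
  -- Both sides have degree less than `m` and agree at the `m` distinct points `ξ j`, where `D`
  -- vanishes.
  have hBeq : B = (H %ₘ DV).map V.subtype := by
    refine eq_of_degrees_lt_of_eval_index_eq Finset.univ (v := ξ) hξ.injOn ?_ ?_ ?_
    · simpa using hB
    · refine (degree_map_le).trans_lt ((degree_modByMonic_lt H hDV).trans_le ?_)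
      rw [degree_eq_natDegree hDV.ne_zero, hdeg]
      simp
    · intro j _
      have h1 := h (ξ j) (hξ0 j) (hξS j)
      have hDj : eval (ξ j) (DV.map V.subtype) = 0 := by
        rw [hmap, eval_prod, Finset.prod_eq_zero (Finset.mem_univ j) (by simp)]
      rw [hDj, mul_zero, zero_add] at h1
      rw [← h1, ← hH]
      conv_lhs => rw [← modByMonic_add_div H DV]
      rw [Polynomial.map_add, Polynomial.map_mul, eval_add, eval_mul, hDj, zero_mul, add_zero]
  refine ⟨B, hB, fun k => ?_, ?_⟩
  · rw [hBeq, coeff_map]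
    exact Subtype.property _
  · rw [h x hx rfl, hmap, eval_prod]
    simp

/-- When the largest step is `1`, the points of the orbit other than `x` are given by `S'(x)`. -/
theorem Model.S'_eq_of_isGreatest_one [CharZero F] (hm : ∀ k ∈ W.steps, -(m : ℤ) ≤ k)
    (hM : IsGreatest (W.steps : Set ℤ) 1) {x : A} (hx : x ≠ 0) {ξ : Fin m → A}
    (hξ : Function.Injective ξ) (hξ0 : ∀ j, ξ j ≠ 0) (hξS : ∀ j, W.S (ξ j) = W.S x)
    (hξx : ∀ j, ξ j ≠ x) :
    W.S' x = algebraMap F A (W.weight 1) * ∏ j, (1 - x⁻¹ * ξ j) := by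
  have hM1 : IsGreatest (W.steps : Set ℤ) ((1 : ℕ) : ℤ) := hM
  have hdeg := natDegree_kernelPoly hm one_pos hM1 (W.S x)
  set w := algebraMap F A (W.weight 1)
  have hmonic : ((X - C x) * ∏ j, (X - C (ξ j))).Monic :=
    (monic_X_sub_C x).mul (monic_prod_of_monic _ _ fun j _ => monic_X_sub_C _)
  have hnat : ((X - C x) * ∏ j, (X - C (ξ j))).natDegree = m + 1 := by
    rw [(monic_X_sub_C x).natDegree_mul (monic_prod_of_monic _ _ fun j _ => monic_X_sub_C _),
      natDegree_finsetProd_X_sub_C_eq_card, natDegree_X_sub_C]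
    simp [add_comm]
  have hw : w ≠ 0 := by simpa [w] using W.weight_ne_zero _ hM.1
  -- Same degree `m + 1`, same leading coefficient, and same values at the `m + 1` points `x, ξ j`
  -- (`none` stands for `x`).
  have hP : W.kernelPoly m (W.S x) = C w * ((X - C x) * ∏ j, (X - C (ξ j))) := by
    refine eq_of_degree_sub_lt_of_eval_index_eq (Finset.univ : Finset (Option (Fin m)))
      (v := fun o => o.elim x ξ) ?_ ?_ ?_
    · rintro (_ | i) _ (_ | j) _ h
      · rfl
      · exact absurd h.symm (hξx j)
      · exact absurd h (hξx i)
      · exact congrArg some (hξ h)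
    · have h0 := kernelPoly_ne_zero hm one_pos hM1 (W.S x)
      refine (degree_sub_lt_left ?_ h0 ?_).trans_le ?_
      · rw [degree_C_mul hw, degree_eq_natDegree h0, degree_eq_natDegree hmonic.ne_zero, hnat,
          hdeg.1]
      · rw [hdeg.2, leadingCoeff_mul, hmonic.leadingCoeff, leadingCoeff_C, mul_one]
        rfl
      · rw [degree_eq_natDegree h0, hdeg.1]
        simp
    · rintro (_ | j) _
      · simp [eval_kernelPoly hm _ hx]
      · simp [eval_kernelPoly hm _ (hξ0 j), hξS, eval_prod, Finset.prod_eq_zero (Finset.mem_univ j)]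
  have h := eval_derivative_kernelPoly hm hx (rfl : W.S x = W.S x)
  rw [hP, derivative_mul, derivative_C, zero_mul, zero_add, derivative_mul, derivative_X_sub_C] at h
  simp only [eval_mul, eval_add, eval_C, eval_sub, eval_X, sub_self, zero_mul,
    add_zero, one_mul, eval_prod] at h
  refine mul_left_cancel₀ (pow_ne_zero m hx) ?_
  rw [← h, mul_left_comm]
  congr 1
  have : x ^ m = ∏ _j : Fin m, x := by simp
  rw [this, ← Finset.prod_mul_distrib]
  refine Finset.prod_congr rfl fun j _ => ?_
  field_simp

end SmallRoots

/-! ### Hensel's lemma for power series. -/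

section Hensel

open Polynomial

variable {F : Type*} [Field F]

/-- Hensel's lemma for power series over a field. -/
theorem exists_powerSeries_isRoot {f : (PowerSeries F)[X]} {w : F} (hw : w ≠ 0)
    (hf : f.leadingCoeff = PowerSeries.C w) {a : F}
    (h0 : (f.map PowerSeries.constantCoeff).eval a = 0)
    (h1 : (f.map PowerSeries.constantCoeff).derivative.eval a ≠ 0) :
    ∃ y : PowerSeries F, f.eval y = 0 ∧ PowerSeries.constantCoeff y = a := by
  have hC : (PowerSeries.C w⁻¹ : PowerSeries F) * PowerSeries.C w = 1 := by
    rw [← map_mul, inv_mul_cancel₀ hw, map_one]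
  have heval : ∀ g : (PowerSeries F)[X], PowerSeries.constantCoeff (g.eval (PowerSeries.C a)) =
      (g.map PowerSeries.constantCoeff).eval a := by
    intro g
    rw [← PowerSeries.constantCoeff_C a, ← eval₂_at_apply, PowerSeries.constantCoeff_C,
      eval_map]
  have hmem : ∀ g : PowerSeries F, g ∈ Ideal.span {(PowerSeries.X : PowerSeries F)} ↔
      PowerSeries.constantCoeff g = 0 := by
    intro g
    rw [Ideal.mem_span_singleton, PowerSeries.X_dvd_iff]
  -- The Henselian property is stated for monic polynomials, hence the division by `w`.
  obtain ⟨y, hy, hya⟩ := HenselianRing.is_henselian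
    (I := Ideal.span {(PowerSeries.X : PowerSeries F)}) (C (PowerSeries.C w⁻¹) * f)
    (monic_C_mul_of_mul_leadingCoeff_eq_one (by rw [hf, hC])) (PowerSeries.C a)
    (by
      rw [hmem, eval_mul, map_mul, heval f, h0, mul_zero])
    (by
      refine IsUnit.map _ (PowerSeries.isUnit_iff_constantCoeff.2 ?_)
      rw [derivative_C_mul, eval_mul, map_mul, heval (derivative f)]
      simpa [hw] using h1)
  refine ⟨y, ?_, ?_⟩
  · rw [IsRoot, eval_mul, eval_C] at hy
    refine (mul_eq_zero.1 hy).resolve_left ?_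
    exact left_ne_zero_of_mul_eq_one hC
  · rw [hmem, map_sub, PowerSeries.constantCoeff_C, sub_eq_zero] at hya
    exact hya

/-- Solutions in power series of the equations `∑ wᵢ s ^ dᵢ y ^ eᵢ = (∑ wᵢ s ^ d'ᵢ) y ^ q` that
reduce to `w y ^ p = w' y ^ q` at `s = 0`. -/
theorem exists_powerSeries_solution [CharZero F] (I : Finset ℤ) (w : ℤ → F) (e d d' : ℤ → ℕ)
    {p q : ℕ} (hqp : q < p) {i₀ i₁ : ℤ} (hi₀ : i₀ ∈ I) (hi₁ : i₁ ∈ I) (hw : w i₀ ≠ 0)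
    (he₀ : e i₀ = p) (he : ∀ i ∈ I, i ≠ i₀ → e i < p) (hd : ∀ i ∈ I, d i = 0 ↔ i = i₀)
    (hd' : ∀ i ∈ I, d' i = 0 ↔ i = i₁) {a : F} (ha0 : a ≠ 0) (ha : w i₀ * a ^ (p - q) = w i₁) :
    ∃ y : PowerSeries F, PowerSeries.constantCoeff y = a ∧
      ∑ i ∈ I, PowerSeries.C (w i) * PowerSeries.X ^ d i * y ^ e i =
        (∑ i ∈ I, PowerSeries.C (w i) * PowerSeries.X ^ d' i) * y ^ q := by
  set R : PowerSeries F := ∑ i ∈ I, PowerSeries.C (w i) * PowerSeries.X ^ d' i with hR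
  have hconst : ∀ (δ : ℤ → ℕ) (j : ℤ), (∀ i ∈ I, δ i = 0 ↔ i = j) → ∀ i ∈ I,
      PowerSeries.constantCoeff (PowerSeries.C (w i) * PowerSeries.X ^ δ i) =
        if i = j then w i else 0 := by
    intro δ j h i hi
    by_cases hij : i = j
    · rw [if_pos hij, (h i hi).2 hij]
      simp
    · have : δ i ≠ 0 := fun h0 => hij ((h i hi).1 h0)
      rw [if_neg hij]
      simp [this]
  have hR0 : PowerSeries.constantCoeff R = w i₁ := by
    rw [hR, map_sum, Finset.sum_congr rfl (hconst d' i₁ hd'), Finset.sum_ite_eq', if_pos hi₁]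
  set f : (PowerSeries F)[X] :=
    ∑ i ∈ I, monomial (e i) (PowerSeries.C (w i) * PowerSeries.X ^ d i) - monomial q R with hf
  have hcoeff : f.coeff p = PowerSeries.C (w i₀) := by
    simp only [hf, coeff_sub, finsetSum_coeff, coeff_monomial]
    rw [Finset.sum_eq_single i₀, if_pos he₀, if_neg hqp.ne, (hd _ hi₀).2 rfl]
    · simp
    · exact fun i hi hne => if_neg (he i hi hne).ne
    · exact fun h => absurd hi₀ h
  have hCw : (PowerSeries.C (w i₀) : PowerSeries F) ≠ 0 := by
    simpa using hw
  have hdeg : f.natDegree = p := by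
    refine natDegree_eq_of_le_of_coeff_ne_zero ?_ (by rwa [hcoeff])
    rw [hf]
    refine (natDegree_sub_le _ _).trans (max_le ?_ (le_trans (natDegree_monomial_le _) hqp.le))
    refine natDegree_sum_le_of_forall_le I
      (fun i => monomial (e i) (PowerSeries.C (w i) * PowerSeries.X ^ d i)) fun i hi => ?_
    refine le_trans (natDegree_monomial_le _) ?_
    by_cases h : i = i₀
    · rw [h, he₀]
    · exact (he i hi h).le
  have hmap : f.map PowerSeries.constantCoeff = monomial p (w i₀) - monomial q (w i₁) := by
    rw [hf, Polynomial.map_sub, Polynomial.map_sum, Polynomial.map_monomial, hR0]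
    congr 1
    rw [Finset.sum_eq_single i₀, Polynomial.map_monomial, hconst d i₀ hd i₀ hi₀, if_pos rfl, he₀]
    · intro i hi hne
      rw [Polynomial.map_monomial, hconst d i₀ hd i hi, if_neg hne, monomial_zero_right]
    · exact fun h => absurd hi₀ h
  obtain ⟨y, hy, hya⟩ := exists_powerSeries_isRoot hw (by rw [leadingCoeff, hdeg, hcoeff])
    (a := a) (f := f)
    (by
      rw [hmap, eval_sub, eval_monomial, eval_monomial, ← ha, mul_assoc, ← pow_add,
        Nat.sub_add_cancel hqp.le, sub_self])
    (by
      rw [hmap, derivative_sub, derivative_monomial, derivative_monomial, eval_sub, eval_monomial,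
        eval_monomial, ← ha]
      -- The derivative of the reduced equation at `a`; it is nonzero because `p ≠ q` in
      -- characteristic `0`, so the root is simple.
      have h1 : w i₀ * (p : F) * a ^ (p - 1) - w i₀ * a ^ (p - q) * (q : F) * a ^ (q - 1) =
          w i₀ * ((p : F) - q) * a ^ (p - 1) := by
        cases q with
        | zero => simp
        | succ q =>
          rw [show p - 1 = p - (q + 1) + (q + 1 - 1) by omega, pow_add]
          ring
      rw [h1]
      refine mul_ne_zero (mul_ne_zero hw (sub_ne_zero.2 ?_)) (pow_ne_zero _ ha0)
      exact_mod_cast hqp.ne')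
  refine ⟨y, hya, ?_⟩
  rw [hf, eval_sub, eval_finsetSum, sub_eq_zero] at hy
  simpa [eval_monomial] using hy

end Hensel

/-! ### Power series in `x̄ ^ (1/n)` as Puiseux series. -/

section PuiseuxRoots

variable (F : Type*) [Field F]

/-- The substitution of `x̄ ^ (1/n)` for the variable of a power series. -/
def puiseuxOfPowerSeries (n : ℕ) (hn : 0 < n) : PowerSeries F →+* Puiseux F :=
  ((HahnSeries.embDomainRingHom (R := F)
      ({ toFun := fun k => (k : ℚ) / n
         map_zero' := by simp
         map_add' := fun a b => by push_cast; ring } : ℕ →+ ℚ)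
      (fun a b h => by
        have hn' : (n : ℚ) ≠ 0 := by positivity
        have h' : (a : ℚ) / n = b / n := h
        rw [div_left_inj' hn'] at h'
        exact_mod_cast h')
      (fun a b => by
        have hn' : (0 : ℚ) < n := by exact_mod_cast hn
        change (a : ℚ) / n ≤ b / n ↔ a ≤ b
        rw [div_le_div_iff_of_pos_right hn']
        exact_mod_cast Iff.rfl)).comp
    (HahnSeries.toPowerSeries.symm : PowerSeries F ≃+* HahnSeries ℕ F).toRingHom).codRestrict
    (Puiseux F) fun f => ⟨n, hn, fun q hq => by
      obtain ⟨k, -, hk⟩ := HahnSeries.support_embDomain_subset hq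
      exact ⟨k, by rw [← hk]; simp⟩⟩

variable {F}

theorem coeff_puiseuxOfPowerSeries (n : ℕ) (hn : 0 < n) (f : PowerSeries F) (k : ℕ) :
    (puiseuxOfPowerSeries F n hn f : HahnSeries ℚ F).coeff ((k : ℚ) / n) =
      PowerSeries.coeff k f :=
  HahnSeries.embDomain_coeff (f := ⟨⟨fun k : ℕ => (k : ℚ) / n, _⟩, _⟩)
    (x := HahnSeries.toPowerSeries.symm f)

theorem exists_of_mem_support_puiseuxOfPowerSeries {n : ℕ} {hn : 0 < n} {f : PowerSeries F} {q : ℚ}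
    (hq : (puiseuxOfPowerSeries F n hn f : HahnSeries ℚ F).coeff q ≠ 0) :
    ∃ k : ℕ, q = k / n ∧ PowerSeries.coeff k f ≠ 0 := by
  obtain ⟨k, -, hk⟩ := HahnSeries.support_embDomain_subset hq
  have hk' : q = (k : ℚ) / n := hk.symm
  refine ⟨k, hk', ?_⟩
  rwa [hk', coeff_puiseuxOfPowerSeries] at hq

theorem puiseux_ext {f g : Puiseux F}
    (h : ∀ q, (f : HahnSeries ℚ F).coeff q = (g : HahnSeries ℚ F).coeff q) : f = g :=
  Subtype.ext (HahnSeries.ext (funext h))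

theorem coe_algebraMap_puiseux (a : F) :
    (algebraMap F (Puiseux F) a : HahnSeries ℚ F) = HahnSeries.single 0 a := rfl

theorem coe_puiseuxOfPowerSeries (n : ℕ) (hn : 0 < n) (k : ℕ) (a : F) :
    (puiseuxOfPowerSeries F n hn (PowerSeries.monomial k a) : HahnSeries ℚ F) =
      HahnSeries.single ((k : ℚ) / n) a := by
  have hn' : (n : ℚ) ≠ 0 := by positivity
  ext q
  by_cases hq : ∃ j : ℕ, q = j / n
  · obtain ⟨j, rfl⟩ := hq
    rw [coeff_puiseuxOfPowerSeries, PowerSeries.coeff_monomial]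
    by_cases hjk : j = k
    · rw [hjk, if_pos rfl, HahnSeries.coeff_single_same]
    · rw [if_neg hjk, HahnSeries.coeff_single_of_ne]
      rw [ne_eq, div_left_inj' hn']
      exact_mod_cast hjk
  · have h1 : (puiseuxOfPowerSeries F n hn (PowerSeries.monomial k a) : HahnSeries ℚ F).coeff q
        = 0 := by
      by_contra h
      obtain ⟨j, hj, -⟩ := exists_of_mem_support_puiseuxOfPowerSeries h
      exact hq ⟨j, hj⟩
    rw [h1, HahnSeries.coeff_single_of_ne fun h => hq ⟨k, h⟩]

theorem puiseuxOfPowerSeries_C (n : ℕ) (hn : 0 < n) (a : F) :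
    puiseuxOfPowerSeries F n hn (PowerSeries.C a) = algebraMap F (Puiseux F) a := by
  refine Subtype.ext ?_
  rw [← PowerSeries.monomial_zero_eq_C_apply, coe_puiseuxOfPowerSeries, coe_algebraMap_puiseux]
  simp

theorem puiseuxOfPowerSeries_X_pow (n : ℕ) (hn : 0 < n) :
    puiseuxOfPowerSeries F n hn PowerSeries.X ^ n = xbar F := by
  have hn' : (n : ℚ) ≠ 0 := by positivity
  refine Subtype.ext ?_
  rw [← map_pow, PowerSeries.X_pow_eq, coe_puiseuxOfPowerSeries, div_self hn']
  rfl

theorem xbar_ne_zero : xbar F ≠ 0 := fun h => by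
  have h' : (HahnSeries.single (1 : ℚ) (1 : F)) = 0 := congrArg Subtype.val h
  exact one_ne_zero (HahnSeries.single_eq_zero_iff.1 h')

theorem coe_inv_xbar_pow (k : ℕ) :
    (((xbar F)⁻¹ ^ k : Puiseux F) : HahnSeries ℚ F) = HahnSeries.single (-(k : ℚ)) 1 := by
  have h : (xbar F)⁻¹ = ⟨HahnSeries.single (-1) 1, 1, one_pos, fun q hq =>
      ⟨-1, by simpa using HahnSeries.support_single_subset hq⟩⟩ := by
    refine inv_eq_of_mul_eq_one_right (Subtype.ext ?_)
    change HahnSeries.single (1 : ℚ) (1 : F) * HahnSeries.single (-1 : ℚ) (1 : F) = 1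
    rw [HahnSeries.single_mul_single]
    simp
  rw [h]
  change (HahnSeries.single (-1 : ℚ) (1 : F)) ^ k = _
  rw [HahnSeries.single_pow]
  simp

theorem inv_xbar_notMem_range : (xbar F)⁻¹ ∉ Set.range (algebraMap F (Puiseux F)) := by
  rintro ⟨a, ha⟩
  have h := congrArg (fun f : Puiseux F => (f : HahnSeries ℚ F).coeff (-1)) ha
  have h1 := coe_inv_xbar_pow (F := F) 1
  rw [pow_one] at h1
  simp only [h1, coe_algebraMap_puiseux] at h
  simp at h

end PuiseuxRoots

/-! ### Large and small roots of `S(X) = S(x)`. -/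

section Roots

variable {F : Type*} [Field F] {W : Model F} {m M : ℕ}

theorem pow_toNat_sub_eq {A : Type*} [Field A] {z : A} (hz : z ≠ 0) {i : ℤ} (hi : i ≤ M) :
    z ^ ((M : ℤ) - i).toNat = z ^ M * (z⁻¹) ^ i := by
  have := pow_mul_zpow_eq_pow_toNat (m := M) hz (i := -i) (by omega)
  rw [inv_zpow', ← this]
  congr 2
  ring

theorem puiseuxOfPowerSeries_ne_zero {n : ℕ} (hn : 0 < n) {y : PowerSeries F}
    (hy : PowerSeries.constantCoeff y ≠ 0) : puiseuxOfPowerSeries F n hn y ≠ 0 := by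
  intro h
  have h1 := coeff_puiseuxOfPowerSeries n hn y 0
  rw [h] at h1
  exact hy (by simpa using h1.symm)

/-- Put `X = x y` and multiply the equation by `x̄ ^ M y ^ m`; at `x̄ = 0` it reduces to `y ^ (m +
M) = y ^ m`, up to the factor `w_M`. -/
theorem Model.exists_large_root [CharZero F] (hm : IsLeast (W.steps : Set ℤ) (-(m : ℤ)))
    (hM0 : 0 < M) (hM : IsGreatest (W.steps : Set ℤ) (M : ℤ)) {a : F} (ha : a ^ M = 1) :
    ∃ y : PowerSeries F, PowerSeries.constantCoeff y = a ∧
      (xbar F)⁻¹ * puiseuxOfPowerSeries F 1 one_pos y ∈ W.roots := by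
  have ha0 : a ≠ 0 := by
    rintro rfl
    rw [zero_pow hM0.ne'] at ha
    exact zero_ne_one ha
  obtain ⟨y, hya, hy⟩ := exists_powerSeries_solution W.steps W.weight (fun i => (i + m).toNat)
    (fun i => ((M : ℤ) - i).toNat) (fun i => ((M : ℤ) - i).toNat) (p := m + M) (q := m)
    (by omega) hM.1 hM.1 (W.weight_ne_zero _ hM.1) (by omega)
    (fun i hi hne => by have := hM.2 hi; omega)
    (fun i hi => by have := hM.2 hi; omega) (fun i hi => by have := hM.2 hi; omega) ha0
    (by rw [Nat.add_sub_cancel_left, ha, mul_one])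
  refine ⟨y, hya, ?_⟩
  set φ := puiseuxOfPowerSeries F 1 one_pos
  have hY : φ y ≠ 0 := puiseuxOfPowerSeries_ne_zero one_pos (by rwa [hya])
  have hs : φ PowerSeries.X = xbar F := by
    rw [← puiseuxOfPowerSeries_X_pow 1 one_pos, pow_one]
  have hb := xbar_ne_zero (F := F)
  refine ⟨mul_ne_zero (inv_ne_zero hb) hY, ?_⟩
  have h := congrArg φ hy
  simp only [map_sum, map_mul, map_pow, hs, φ, puiseuxOfPowerSeries_C] at h
  refine mul_left_cancel₀ (mul_ne_zero (pow_ne_zero M hb) (pow_ne_zero m hY)) ?_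
  rw [Model.S, Model.S, Finset.mul_sum, Finset.mul_sum]
  rw [Finset.sum_mul] at h
  refine (Finset.sum_congr rfl fun i hi => ?_).trans
    (h.trans (Finset.sum_congr rfl fun i hi => ?_))
  · rw [pow_toNat_sub_eq hb (hM.2 hi), pow_mul_zpow_eq_pow_toNat hY (hm.2 hi), mul_zpow]
    ring
  · rw [pow_toNat_sub_eq hb (hM.2 hi)]
    ring

/-- With `s = x̄ ^ (1/m)`, put `X = s ^ M / z` and multiply by `s ^ (m M) z ^ M`; at `s = 0` this
reduces to `w_{-m} z ^ (M + m) = w_M z ^ M`. The unknown is `z` rather than `1/z` so that the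
leading coefficient is the constant `w_{-m}`, as Hensel's lemma requires. -/
theorem Model.exists_small_root [CharZero F] (hm : IsLeast (W.steps : Set ℤ) (-(m : ℤ)))
    (hm0 : 0 < m) (hM0 : 0 < M) (hM : IsGreatest (W.steps : Set ℤ) (M : ℤ)) {a : F}
    (ha : a ^ m = W.weight M / W.weight (-m)) :
    ∃ z : PowerSeries F, PowerSeries.constantCoeff z = a ∧ a ≠ 0 ∧
      puiseuxOfPowerSeries F m hm0 (PowerSeries.X ^ M * z⁻¹) ∈ W.roots := by
  have hwm := W.weight_ne_zero _ hm.1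
  have hwM := W.weight_ne_zero _ hM.1
  have ha0 : a ≠ 0 := by
    rintro rfl
    rw [zero_pow hm0.ne'] at ha
    exact div_ne_zero hwM hwm ha.symm
  have hmM : ∀ i : ℤ, M * (i + m).toNat = 0 ↔ (i + m).toNat = 0 := by simp [hM0.ne']
  have hmM' : ∀ i : ℤ, m * ((M : ℤ) - i).toNat = 0 ↔ ((M : ℤ) - i).toNat = 0 := by
    simp [hm0.ne']
  obtain ⟨z, hza, hz⟩ := exists_powerSeries_solution W.steps W.weight
    (fun i => ((M : ℤ) - i).toNat) (fun i => M * (i + m).toNat)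
    (fun i => m * ((M : ℤ) - i).toNat) (p := M + m) (q := M) (i₀ := -(m : ℤ)) (i₁ := M)
    (by omega) hm.1 hM.1 hwm (by omega)
    (fun i hi hne => by have := hm.2 hi; omega)
    (fun i hi => by have := hm.2 hi; rw [hmM]; omega)
    (fun i hi => by have := hM.2 hi; rw [hmM']; omega) ha0
    (by rw [Nat.add_sub_cancel_left, ha, mul_div_cancel₀ _ hwm])
  refine ⟨z, hza, ha0, ?_⟩
  set φ := puiseuxOfPowerSeries F m hm0
  have hZ : φ z ≠ 0 := puiseuxOfPowerSeries_ne_zero hm0 (by rwa [hza])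
  have hsm : φ PowerSeries.X ^ m = xbar F := puiseuxOfPowerSeries_X_pow m hm0
  have hb := xbar_ne_zero (F := F)
  have hs : φ PowerSeries.X ≠ 0 := fun h => hb (by rw [← hsm, h, zero_pow hm0.ne'])
  have hinv : φ z⁻¹ = (φ z)⁻¹ := by
    refine eq_inv_of_mul_eq_one_left ?_
    rw [← map_mul, PowerSeries.inv_mul_cancel _ (by rwa [hza]), map_one]
  rw [map_mul, map_pow, hinv]
  refine ⟨mul_ne_zero (pow_ne_zero _ hs) (inv_ne_zero hZ), ?_⟩
  have h := congrArg φ hz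
  simp only [map_sum, map_mul, map_pow, φ, puiseuxOfPowerSeries_C] at h
  refine mul_left_cancel₀
    (mul_ne_zero (pow_ne_zero m (pow_ne_zero M hs)) (pow_ne_zero M hZ)) ?_
  rw [Model.S, Model.S, Finset.mul_sum, Finset.mul_sum]
  rw [Finset.sum_mul] at h
  refine (Finset.sum_congr rfl fun i hi => ?_).trans
    (h.trans (Finset.sum_congr rfl fun i hi => ?_))
  · rw [pow_toNat_sub_eq hZ (hM.2 hi), pow_mul,
      pow_mul_zpow_eq_pow_toNat (pow_ne_zero M hs) (hm.2 hi), mul_zpow]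
    ring
  · rw [pow_mul, hsm, pow_toNat_sub_eq hb (hM.2 hi), ← hsm, ← pow_mul, ← pow_mul, mul_comm m M]
    ring

theorem encard_setOf_pow_eq [IsAlgClosed F] [CharZero F] {n : ℕ} (hn : 0 < n) {b : F}
    (hb : b ≠ 0) : {a : F | a ^ n = b}.encard = n := by
  classical
  have hn' : (n : F) ≠ 0 := by exact_mod_cast hn.ne'
  have hsep := Polynomial.separable_X_pow_sub_C b hn' hb
  have h1 : {a : F | a ^ n = b} =
      ((Polynomial.X ^ n - Polynomial.C b : Polynomial F).roots.toFinset : Set F) := by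
    ext a
    simp [Polynomial.X_pow_sub_C_ne_zero hn b, sub_eq_zero]
  rw [h1, Set.encard_coe_eq_coe_finsetCard,
    Multiset.toFinset_card_of_nodup (Polynomial.nodup_roots hsep),
    ← (IsAlgClosed.splits _).natDegree_eq_card_roots, Polynomial.natDegree_X_pow_sub_C]

theorem Model.exists_subset_smallRoots [IsAlgClosed F] [CharZero F]
    (hm : IsLeast (W.steps : Set ℤ) (-(m : ℤ))) (hM0 : 0 < M)
    (hM : IsGreatest (W.steps : Set ℤ) (M : ℤ)) :
    ∃ T ⊆ W.roots, T.encard = m ∧ ∀ X ∈ T, ∀ q : ℚ, 0 ≤ q → xCoeff q X = 0 := by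
  rcases Nat.eq_zero_or_pos m with rfl | hm0
  · exact ⟨∅, Set.empty_subset _, by simp, by simp⟩
  have hwm := W.weight_ne_zero _ hm.1
  have hwM := W.weight_ne_zero _ hM.1
  have h : ∀ a ∈ {a : F | a ^ m = W.weight M / W.weight (-m)}, _ :=
    fun a ha => exists_small_root hm hm0 hM0 hM ha
  choose! z hz ha0 hroot using h
  refine ⟨(fun a => puiseuxOfPowerSeries F m hm0 (PowerSeries.X ^ M * (z a)⁻¹)) ''
    {a : F | a ^ m = W.weight M / W.weight (-m)}, ?_, ?_, ?_⟩
  · rintro _ ⟨a, ha, rfl⟩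
    exact hroot a ha
  · rw [Set.InjOn.encard_image, encard_setOf_pow_eq hm0 (div_ne_zero hwM hwm)]
    intro a ha b hb hab
    -- The coefficient of `x̄ ^ (M/m)` is `a⁻¹`, so distinct `a` give distinct roots.
    have h1 := congrArg (fun f : Puiseux F => (f : HahnSeries ℚ F).coeff ((M : ℕ) / m)) hab
    simp only [coeff_puiseuxOfPowerSeries, PowerSeries.coeff_X_pow_mul', le_refl, if_true,
      Nat.sub_self, PowerSeries.coeff_zero_eq_constantCoeff, PowerSeries.constantCoeff_inv] at h1
    rw [hz a ha, hz b hb] at h1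
    exact inv_injective h1
  · rintro _ ⟨a, ha, rfl⟩ q hq
    by_contra hne
    obtain ⟨k, hk, hk'⟩ := exists_of_mem_support_puiseuxOfPowerSeries hne
    have h0 : (0 : ℚ) ≤ (k : ℚ) / m := by positivity
    have h1 : (k : ℚ) / m = 0 := by linarith
    have hk0 : k = 0 := by
      have hm' : (m : ℚ) ≠ 0 := by positivity
      rcases div_eq_zero_iff.1 h1 with h | h
      · exact_mod_cast h
      · exact absurd h hm'
    refine hk' ?_
    rw [hk0, PowerSeries.coeff_X_pow_mul', if_neg (by omega)]

theorem Model.exists_subset_largeRoots [IsAlgClosed F] [CharZero F]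
    (hm : IsLeast (W.steps : Set ℤ) (-(m : ℤ))) (hM0 : 0 < M)
    (hM : IsGreatest (W.steps : Set ℤ) (M : ℤ)) :
    ∃ T ⊆ W.roots, T.encard = M ∧ ∀ X ∈ T, xCoeff 1 X ≠ 0 := by
  have h : ∀ a ∈ {a : F | a ^ M = 1}, _ := fun a ha => exists_large_root hm hM0 hM ha
  choose! y hy hroot using h
  have hcoeff : ∀ a ∈ {a : F | a ^ M = 1},
      xCoeff 1 ((xbar F)⁻¹ * puiseuxOfPowerSeries F 1 one_pos (y a)) = a := by
    intro a ha
    have h1 := coe_inv_xbar_pow (F := F) 1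
    rw [pow_one] at h1
    have h2 := coeff_puiseuxOfPowerSeries 1 one_pos (y a) 0
    rw [PowerSeries.coeff_zero_eq_constantCoeff, hy a ha, Nat.cast_zero, zero_div] at h2
    rw [xCoeff, Subfield.coe_mul, h1]
    have h3 := HahnSeries.coeff_single_mul_add (r := (1 : F)) (a := (0 : ℚ)) (b := -((1 : ℕ) : ℚ))
      (x := (puiseuxOfPowerSeries F 1 one_pos (y a) : HahnSeries ℚ F))
    simpa [h2] using h3
  refine ⟨(fun a => (xbar F)⁻¹ * puiseuxOfPowerSeries F 1 one_pos (y a)) '' {a : F | a ^ M = 1},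
    ?_, ?_, ?_⟩
  · rintro _ ⟨a, ha, rfl⟩
    exact hroot a ha
  · rw [Set.InjOn.encard_image, encard_setOf_pow_eq hM0 one_ne_zero]
    intro a ha b hb hab
    rw [← hcoeff a ha, ← hcoeff b hb]
    exact congrArg (xCoeff 1) hab
  · rintro _ ⟨a, ha, rfl⟩
    change xCoeff 1 ((xbar F)⁻¹ * puiseuxOfPowerSeries F 1 one_pos (y a)) ≠ 0
    rw [hcoeff a ha]
    rintro rfl
    exact zero_ne_one ((zero_pow hM0.ne').symm.trans ha)

/-- The `m` roots without non-negative powers of `x` are small, the `M` roots with a term in `x` are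
not, and there are at most `m + M` roots: all the inequalities are equalities. In particular every
small root is one of those constructed, so it has no constant term. -/
theorem Model.encard_roots [IsAlgClosed F] [CharZero F]
    (hm : IsLeast (W.steps : Set ℤ) (-(m : ℤ))) (hM0 : 0 < M)
    (hM : IsGreatest (W.steps : Set ℤ) (M : ℤ)) :
    W.roots.encard = m + M ∧ W.smallRoots.encard = m ∧
      ∀ X ∈ W.smallRoots, ∀ q : ℚ, 0 ≤ q → xCoeff q X = 0 := by
  obtain ⟨T, hT, hTm, hT0⟩ := exists_subset_smallRoots hm hM0 hM
  obtain ⟨U, hU, hUM, hU1⟩ := exists_subset_largeRoots hm hM0 hM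
  have hle : W.roots.encard ≤ m + M := encard_setOf_S_eq_le hm hM0 hM
    (S_notMem_range (fun k hk => hm.2 hk) hM0 hM inv_xbar_notMem_range)
  have hTs : T ⊆ W.smallRoots := fun X hX => ⟨hT hX, fun q hq => hT0 X hX q hq.le⟩
  have hUs : U ⊆ W.roots \ W.smallRoots := fun X hX => ⟨hU hX, fun h => hU1 X hX (h.2 1 one_pos)⟩
  have hsub : W.smallRoots ⊆ W.roots := fun X hX => hX.1
  have hadd := Set.encard_sdiff_add_encard_of_subset hsub
  have h1 := Set.encard_le_encard hTs
  have h2 := Set.encard_le_encard hUs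
  rw [hTm] at h1
  rw [hUM] at h2
  have hfin : W.roots.Finite :=
    Set.finite_of_encard_le_coe (k := m + M) (by exact_mod_cast hle)
  have hsfin := hfin.subset hsub
  have hdfin := hfin.subset (Set.sdiff_subset (s := W.roots) (t := W.smallRoots))
  rw [← hfin.cast_ncard_eq] at hle hadd ⊢
  rw [← hsfin.cast_ncard_eq] at h1 hadd ⊢
  rw [← hdfin.cast_ncard_eq] at h2 hadd
  norm_cast at hle hadd h1 h2 ⊢
  have hsm : W.smallRoots.ncard = m := by omega
  refine ⟨by omega, hsm, ?_⟩
  have hTeq : T = W.smallRoots := (hsfin.subset hTs).eq_of_subset_of_encard_le hTs (by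
    rw [hTm, ← hsfin.cast_ncard_eq, hsm])
  exact fun X hX => hT0 X (hTeq ▸ hX)

end Roots

/-! ### Extraction of the non-negative part in `x`. -/

section NonnegPart

variable (F : Type*) [Field F]

/-- The Puiseux series in `x̄` without positive powers of `x`. -/
def integralPuiseux : Subring (Puiseux F) where
  carrier := {f | ∀ q < 0, (f : HahnSeries ℚ F).coeff q = 0}
  mul_mem' := by
    intro f g hf hg q hq
    by_contra h
    obtain ⟨a, ha, b, hb, hab⟩ := HahnSeries.support_mul_subset (x := (f : HahnSeries ℚ F))
      (y := (g : HahnSeries ℚ F)) h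
    have hab' : a + b = q := hab
    by_cases ha0 : a < 0
    · exact ha (hf a ha0)
    · exact hb (hg b (by linarith))
  one_mem' := fun q hq => HahnSeries.coeff_single_of_ne hq.ne
  add_mem' := by
    intro f g hf hg q hq
    change (f : HahnSeries ℚ F).coeff q + (g : HahnSeries ℚ F).coeff q = 0
    rw [hf q hq, hg q hq, add_zero]
  zero_mem' := fun q _ => rfl
  neg_mem' := by
    intro f hf q hq
    change -(f : HahnSeries ℚ F).coeff q = 0
    rw [hf q hq, neg_zero]

variable {F}

theorem algebraMap_mem_integralPuiseux (a : F) : algebraMap F (Puiseux F) a ∈ integralPuiseux F :=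
  fun _ hq => HahnSeries.coeff_single_of_ne hq.ne

theorem coeff_xbar_pow_mul (k : ℕ) (f : Puiseux F) (q : ℚ) :
    ((xbar F ^ k * f : Puiseux F) : HahnSeries ℚ F).coeff q =
      (f : HahnSeries ℚ F).coeff (q - k) := by
  have h : ((xbar F ^ k : Puiseux F) : HahnSeries ℚ F) = HahnSeries.single (k : ℚ) 1 := by
    change (HahnSeries.single (1 : ℚ) (1 : F)) ^ k = _
    rw [HahnSeries.single_pow]
    simp
  rw [Subfield.coe_mul, h]
  have h3 := HahnSeries.coeff_single_mul_add (r := (1 : F)) (a := q - k) (b := (k : ℚ))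
    (x := (f : HahnSeries ℚ F))
  rwa [sub_add_cancel, one_mul] at h3

/-- Indices are exponents of `x̄`: `g` carries the non-negative powers of `x` and `r` the negative
ones. -/
theorem nonnegPart_eq_of_add_eq {f g r : Puiseux F} (h : g = f + r)
    (hg : ∀ q > 0, (g : HahnSeries ℚ F).coeff q = 0)
    (hr : ∀ q ≤ 0, (r : HahnSeries ℚ F).coeff q = 0) : g = nonnegPart f := by
  refine puiseux_ext fun q => ?_
  change _ = if q ≤ 0 then (f : HahnSeries ℚ F).coeff q else 0
  split_ifs with hq
  · rw [h]
    change (f : HahnSeries ℚ F).coeff q + (r : HahnSeries ℚ F).coeff q = _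
    rw [hr q hq, add_zero]
  · exact hg q (not_le.1 hq)

theorem coe_sum_puiseux_coeff {ι : Type*} (s : Finset ι) (f : ι → Puiseux F) (q : ℚ) :
    ((∑ i ∈ s, f i : Puiseux F) : HahnSeries ℚ F).coeff q =
      ∑ i ∈ s, (f i : HahnSeries ℚ F).coeff q := by
  classical
  induction s using Finset.induction_on with
  | empty => simp
  | insert a s ha ih =>
    rw [Finset.sum_insert ha, Finset.sum_insert ha, ← ih]
    rfl

/-- The quotient by `x ^ m` of a polynomial in `x` of degree less than `m`, with coefficients
without positive powers of `x`, contains only negative powers of `x`. -/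
theorem coeff_xbar_pow_mul_eval {m : ℕ} {B : Polynomial (Puiseux F)} (hB : B.degree < m)
    (hBV : ∀ k, B.coeff k ∈ integralPuiseux F) {q : ℚ} (hq : q ≤ 0) :
    ((xbar F ^ m * B.eval (xbar F)⁻¹ : Puiseux F) : HahnSeries ℚ F).coeff q = 0 := by
  -- Each `x̄ ^ m x ^ k` with `k < m` is `x̄ ^ (m - k)` with a positive exponent, which
  -- multiplication by `B.coeff k` cannot compensate.
  have h : xbar F ^ m * B.eval (xbar F)⁻¹ =
      ∑ k ∈ Finset.range m, xbar F ^ (m - k) * B.coeff k := by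
    by_cases hB0 : B = 0
    · simp [hB0]
    rw [Polynomial.eval_eq_sum_range' ((Polynomial.natDegree_lt_iff_degree_lt hB0).2 hB),
      Finset.mul_sum]
    refine Finset.sum_congr rfl fun k hk => ?_
    rw [pow_sub₀ _ xbar_ne_zero (Finset.mem_range.1 hk).le, inv_pow]
    ring
  rw [h, coe_sum_puiseux_coeff]
  refine Finset.sum_eq_zero fun k hk => ?_
  rw [coeff_xbar_pow_mul]
  refine hBV k _ ?_
  have : (0 : ℚ) < (m - k : ℕ) := by
    exact_mod_cast Nat.sub_pos_of_lt (Finset.mem_range.1 hk)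
  linarith

variable {W : Model F} {m M : ℕ}

theorem Model.coeff_coeff_Q (n : ℕ) {q : ℚ} (hq : 0 < q) :
    ((PowerSeries.coeff n (W.Q (xbar F)⁻¹) : Puiseux F) : HahnSeries ℚ F).coeff q = 0 := by
  rw [Model.Q, PowerSeries.coeff_mk, coe_sum_puiseux_coeff]
  refine Finset.sum_eq_zero fun s hs => ?_
  obtain ⟨e, he⟩ := Int.eq_ofNat_of_zero_le (W.sum_nonneg_of_mem_walks hs)
  rw [he, zpow_natCast, Subfield.coe_mul, coe_inv_xbar_pow, coe_algebraMap_puiseux,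
    HahnSeries.single_mul_single]
  refine HahnSeries.coeff_single_of_ne ?_
  have : (0 : ℚ) ≤ e := by positivity
  linarith

theorem Model.Q_eq_nonnegPartSeries (hm : ∀ k ∈ W.steps, -(m : ℤ) ≤ k)
    {ξ : Fin m → Puiseux F} (hξ : Function.Injective ξ) (hξr : ∀ j, ξ j ∈ W.smallRoots) :
    W.Q (xbar F)⁻¹ = nonnegPartSeries
      (PowerSeries.C (∏ j, (1 - xbar F * ξ j)) * (W.K (xbar F)⁻¹)⁻¹) := by
  have hb := xbar_ne_zero (F := F)
  ext1 n
  rw [nonnegPartSeries, PowerSeries.coeff_mk, PowerSeries.coeff_C_mul, coeff_inv_K]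
  obtain ⟨B, hB, hBV, h⟩ := exists_pow_mul_coeff_Q_eq_subring hm (integralPuiseux F)
    algebraMap_mem_integralPuiseux (inv_ne_zero hb) hξ (fun j => (hξr j).1.1)
    (fun j => (hξr j).1.2) (fun j q hq => by
      have := (hξr j).2 (-q) (by linarith)
      rwa [xCoeff, neg_neg] at this) n
  refine nonnegPart_eq_of_add_eq (r := xbar F ^ m * B.eval (xbar F)⁻¹) ?_
    (fun q hq => coeff_coeff_Q n hq) fun q hq => coeff_xbar_pow_mul_eval hB hBV hq
  have h1 : xbar F ^ m * ((xbar F)⁻¹ ^ m * PowerSeries.coeff n (W.Q (xbar F)⁻¹)) =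
      PowerSeries.coeff n (W.Q (xbar F)⁻¹) := by
    rw [← mul_assoc, ← mul_pow, mul_inv_cancel₀ hb, one_pow, one_mul]
  have h2 : xbar F ^ m * ∏ j, ((xbar F)⁻¹ - ξ j) = ∏ j, (1 - xbar F * ξ j) := by
    have : xbar F ^ m = ∏ _j : Fin m, xbar F := by simp
    rw [this, ← Finset.prod_mul_distrib]
    refine Finset.prod_congr rfl fun j _ => ?_
    rw [mul_sub, mul_inv_cancel₀ hb]
  rw [← h1, h, mul_add, mul_left_comm, h2, mul_comm]

theorem xCoeff_one_inv_xbar : xCoeff 1 (xbar F)⁻¹ = 1 := by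
  have h := coe_inv_xbar_pow (F := F) 1
  rw [pow_one] at h
  rw [xCoeff, h]
  simp

end NonnegPart

end WeightedWalk

end

/-! ### The main theorem. -/

theorem proposition5p2 {F : Type*} [Field F] [IsAlgClosed F] [CharZero F]
    (W : WeightedWalk.Model F) (m M : ℕ) (hM0 : 0 < M)
    (hm : IsLeast (W.steps : Set ℤ) (-(m : ℤ))) (hM : IsGreatest (W.steps : Set ℤ) (M : ℤ)) :
    -- The orbit of `x` and the section-free equations, in any algebraic closure of `F(x)`.
    (∀ {L : Type*} [Field L] [Algebra F L] [Algebra (RatFunc F) L]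
        [IsScalarTower F (RatFunc F) L] [IsAlgClosure (RatFunc F) L] (x : L),
      x = algebraMap (RatFunc F) L RatFunc.X →
        (W.orbit x).encard = m + M ∧
        (∀ u ∈ W.orbit x, W.Holds (W.orbitEquation m x u)) ∧
        W.sectionFree m x = Submodule.span L
          {e | ∃ u : Fin (m + 1) → L, Function.Injective u ∧ (∀ i, u i ∈ W.orbit x) ∧
            e = W.lagrangeEquation x u} ∧
        (∀ u : Fin (m + 1) → L, Function.Injective u → (∀ i, u i ∈ W.orbit x) →
          W.K x * ∑ i, PowerSeries.C (WeightedWalk.lagrangeCoeff u i) * W.Q (u i) = 1)) ∧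
    -- The roots of `S(X) = S(x)` as Puiseux series in `x̄ = 1/x`.
    W.roots.encard = m + M ∧
    W.smallRoots.encard = m ∧
    (∀ X ∈ W.smallRoots, WeightedWalk.xCoeff 0 X = 0) ∧
    -- The expressions of `Q(x)`, for any enumeration `x_1, …, x_m` of the small roots.
    (∀ ξ : Fin m → WeightedWalk.Puiseux F, Function.Injective ξ → Set.range ξ = W.smallRoots →
      ∀ x xb : WeightedWalk.Puiseux F, xb = WeightedWalk.xbar F → x = xb⁻¹ →
        W.Q x = WeightedWalk.nonnegPartSeries
          (PowerSeries.C (∏ j, (1 - xb * ξ j)) * (W.K x)⁻¹) ∧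
        (M = 1 →
          PowerSeries.C (∏ j, (1 - xb * ξ j)) * (W.K x)⁻¹ =
            PowerSeries.C (W.S' x) *
              (PowerSeries.C (algebraMap F (WeightedWalk.Puiseux F) (W.weight 1)) * W.K x)⁻¹ ∧
          W.Q x = WeightedWalk.nonnegPartSeries
            (PowerSeries.C (W.S' x) *
              (PowerSeries.C (algebraMap F (WeightedWalk.Puiseux F) (W.weight 1)) *
                W.K x)⁻¹))) := by
  have hm' : ∀ k ∈ W.steps, -(m : ℤ) ≤ k := fun k hk => hm.2 hk
  obtain ⟨h1, h2, h3⟩ := WeightedWalk.Model.encard_roots hm hM0 hM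
  refine ⟨?_, h1, h2, fun X hX => h3 X hX 0 le_rfl, ?_⟩
  · intro L _ _ _ _ _ x hx
    have : IsAlgClosed L := IsAlgClosure.isAlgClosed (RatFunc F)
    have hxF : x ∉ Set.range (algebraMap F L) := by
      rintro ⟨a, ha⟩
      rw [hx, IsScalarTower.algebraMap_apply F (RatFunc F) L] at ha
      have h := (algebraMap (RatFunc F) L).injective ha
      rw [RatFunc.algebraMap_eq_C] at h
      have h' := congrArg RatFunc.num h
      rw [RatFunc.num_C, RatFunc.num_X] at h'
      exact Polynomial.X_ne_C a h'.symm
    have hx0 : x ≠ 0 := fun h => hxF ⟨0, by simp [h]⟩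
    have horb : ∀ u ∈ W.orbit x, u ≠ 0 ∧ W.S u = W.S x := fun u hu => by
      rwa [WeightedWalk.Model.orbit_eq hx0] at hu
    refine ⟨?_, ?_, ?_, ?_⟩
    · rw [WeightedWalk.Model.orbit_eq hx0]
      exact WeightedWalk.Model.encard_setOf_S_eq hm hM0 hM
        (WeightedWalk.Model.S_notMem_range hm' hM0 hM hxF)
    · exact fun u hu => WeightedWalk.Model.holds_orbitEquation hm' (horb u hu).1 (horb u hu).2
    · exact WeightedWalk.Model.sectionFree_eq_span hm hx0
    · exact fun u hu huO => WeightedWalk.Model.K_mul_sum_lagrangeCoeff hm' hu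
        (fun i => (horb _ (huO i)).1) fun i => (horb _ (huO i)).2
  · rintro ξ hξ hξr x xb rfl rfl
    have hξs : ∀ j, ξ j ∈ W.smallRoots := fun j => hξr ▸ Set.mem_range_self j
    have hQ := WeightedWalk.Model.Q_eq_nonnegPartSeries hm' hξ hξs
    refine ⟨hQ, ?_⟩
    rintro rfl
    have hS := WeightedWalk.Model.S'_eq_of_isGreatest_one hm' (by exact_mod_cast hM)
      (inv_ne_zero WeightedWalk.xbar_ne_zero) hξ (fun j => (hξs j).1.1) (fun j => (hξs j).1.2)
      -- A small root differs from `x`, whose coefficient of `x ^ 1` is `1`.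
      (fun j h => one_ne_zero (WeightedWalk.xCoeff_one_inv_xbar.symm.trans
        (h ▸ (hξs j).2 1 one_pos)))
    rw [inv_inv] at hS
    have hw : algebraMap F (WeightedWalk.Puiseux F) (W.weight 1) ≠ 0 := by
      simpa using W.weight_ne_zero 1 (by exact_mod_cast hM.1)
    have heq : PowerSeries.C (∏ j, (1 - WeightedWalk.xbar F * ξ j)) *
        (W.K (WeightedWalk.xbar F)⁻¹)⁻¹ = PowerSeries.C (W.S' (WeightedWalk.xbar F)⁻¹) *
          (PowerSeries.C (algebraMap F (WeightedWalk.Puiseux F) (W.weight 1)) *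
            W.K (WeightedWalk.xbar F)⁻¹)⁻¹ := by
      rw [PowerSeries.mul_inv_rev, PowerSeries.C_inv, hS, mul_left_comm, mul_comm,
        ← map_mul, mul_right_comm, mul_inv_cancel₀ hw, one_mul]
    exact ⟨heq, heq ▸ hQ⟩
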